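/- **Setting.** There are $n\ge 1$ candidates, partitioned into an advantaged group $G_1$ and a disadvantaged group $G_2$ with $|G_j|=n_j$, and $p$ institutions with capacities $k_1,\dots,k_p\in\mathbb N$, $K=\sum_\ell k_\ell\le n$. The latent utilities $u_1,\dots,u_n$ are i.i.d. uniform on $[0,1]$; the preference lists $\sigma_1,\dots,\sigma_n$ (strict orderings of the $p$ institutions) are i.i.d. from an arbitrary distribution $\mathcal L$ and independent of the utilities. For a bias parameter $0<\beta\le 1$ the estimated utilities are $\hat u_i=u_i$ for $i\in G_1$ and $\hat u_i=\beta u_i$ for $i\in G_2$. An algorithm $\mathcal A$ maps $(\hat u,\sigma)$ to a selection $M$, i.e. a partial function from candidates to institutions with at most $k_\ell$ candidates assigned to each institution $\ell$; it is *estimated-utility maximizing* if $M$ always maximizes $\sum_{i \text{ assigned by } M}\hat u_i$ among all such selections. Let $\rho_j$ (respectively $\pi_j$) be the fraction of candidates of $G_j$ that $M$ assigns to some institution (respectively to their first choice), and set $$\mathscr R(\mathcal A)=\mathbb E\left[\frac{\min(\rho_1,\rho_2)}{\max(\rho_1,\rho_2)}\right],\quad \mathscr P(\mathcal A)=\mathbb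 E\left[\frac{\min(\pi_1,\pi_2)}{\max(\pi_1,\pi_2)}\right],\quad \mathscr U(\mathcal A)=\mathbb E\left[\frac{\sum_{i\text{ assigned by }M}u_i}{\text{sum of the } K \text{ largest } u_i}\right].$$ The stable assignment algorithm $\mathcal A_{\rm st}$ goes through the candidates in decreasing order of $\hat u_i$ and assigns each to the most preferred institution on its list that still has a vacant slot (if any). **Theorem.** There is an absolute constant $C>0$ such that the following holds for all data as above and all $\eta_1,\eta_2>0$ with $n_j\ge\eta_1 n$ for $j\in\{1,2\}$ and $K\ge\eta_2 n$. Put $$v=\max\left\{\frac{K-n_1(1-\beta)}{K\beta+n_2(1-\beta)},\,0\right\},\qquad f(x,y)=x-\frac{x(x+1)}{2(y+1)},$$ $$\alpha_1=K-\frac{n_2}{\beta n_1+n_2}\max\{K-(1-\beta)n_1,0\},\qquad \alpha_2=K-\alpha_1 .$$ For every estimated-utility-maximizing algorithm $\mathcal A$ the random ratios defining $\mathscr R(\mathcal A)$ and $\mathscr U(\mathcal A)$ are integrable and $$\left|\mathscr R(\mathcal A)-v\right|\le C\,\frac{\sqrt{\log n}}{\eta_1\eta_2\sqrt n},\qquad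 \left|\mathscr U(\mathcal A)-\frac{f(\alpha_1,n_1)+f(\alpha_2,n_2)}{f(K,n)}\right|\le C\,\frac{\sqrt{\log n}}{\eta_2\sqrt n}.$$ If moreover $k_\ell\ge 1$ for every institution $\ell$, then the random ratio defining $\mathscr P(\mathcal A_{\rm st})$ is integrable and $$\mathscr P(\mathcal A_{\rm st})\le v+C\,\frac{p\sqrt{\log n}}{\eta_1\eta_2\sqrt n}.$$ -/

import Mathlib

open MeasureTheory

noncomputable section

namespace CentralSelection

/-- A (strict, complete) preference list over `p` institutions: `s r` is the institution in
position `r` of the list, position `0` being the most preferred one. -/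
abbrev PrefList (p : ℕ) : Type := Equiv.Perm (Fin p)

/-- The set of preference lists is finite and carries the discrete σ-algebra. -/
instance instMeasurableSpacePrefList (p : ℕ) : MeasurableSpace (PrefList p) := ⊤

instance instDiscretePrefList (p : ℕ) : DiscreteMeasurableSpace (PrefList p) :=
  ⟨fun _ => trivial⟩

/-- A selection: a partial function from the candidates to the institutions
(`none` means that the candidate is not selected). -/
abbrev Assignment (n p : ℕ) : Type := Fin n → Option (Fin p)

/-- An algorithm outputs a selection, given the estimated utilities and the preference lists. -/
abbrev Algorithm (n p : ℕ) : Type :=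
  (Fin n → ℝ) → (Fin n → PrefList p) → Assignment n p

variable {n p : ℕ}

/-- The set of candidates assigned to institution `l`. -/
def assignedTo (M : Assignment n p) (l : Fin p) : Finset (Fin n) :=
  Finset.univ.filter (fun i => M i = some l)

/-- The set of candidates assigned to some institution. -/
def selected (M : Assignment n p) : Finset (Fin n) :=
  Finset.univ.filter (fun i => M i ≠ none)

/-- The set of candidates assigned to their most preferred institution. -/
def gotFirst (s : Fin n → PrefList p) (M : Assignment n p) : Finset (Fin n) :=
  Finset.univ.filter (fun i => ∃ r : Fin p, (r : ℕ) = 0 ∧ M i = some (s i r))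

/-- The selection respects the capacities `k`. -/
def Feasible (k : Fin p → ℕ) (M : Assignment n p) : Prop :=
  ∀ l, (assignedTo M l).card ≤ k l

/-- The utility of a selection with respect to a utility vector `v`. -/
def utility (v : Fin n → ℝ) (M : Assignment n p) : ℝ :=
  ∑ i ∈ selected M, v i

/-- The algorithm outputs, for all (nonnegative) estimated utilities and all preference lists, a
selection that has the largest estimated utility among all those respecting the capacities. -/
def MaximizesEstimatedUtility (k : Fin p → ℕ) (A : Algorithm n p) : Prop :=
  ∀ v : Fin n → ℝ, (∀ i, 0 ≤ v i) → ∀ s : Fin n → PrefList p,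
    Feasible k (A v s) ∧ ∀ M : Assignment n p, Feasible k M → utility v M ≤ utility v (A v s)

/-- The candidates listed in decreasing order of `v` (ties in the order of the index). -/
def byDecreasing (v : Fin n → ℝ) : List (Fin n) :=
  (List.finRange n).insertionSort (fun i j => v j ≤ v i)

/-- The sum of the `K` largest entries of `u`. -/
def topSum (K : ℕ) (u : Fin n → ℝ) : ℝ :=
  (((byDecreasing u).take K).map u).sum

/-- The first institution on the preference list `s` that has a vacant slot under the current
partial selection `M`, if there is one. -/
def firstVacant (k : Fin p → ℕ) (s : PrefList p) (M : Assignment n p) : Option (Fin p) :=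
  (List.ofFn (fun r => s r)).find? (fun l => decide ((assignedTo M l).card < k l))

/-- The stable assignment algorithm: starting with nobody assigned, go through the candidates in
decreasing order of estimated utility, and assign each to the most preferred institution on its
list that still has a vacant slot. -/
def stableAlg (k : Fin p → ℕ) : Algorithm n p := fun v s =>
  (byDecreasing v).foldl
    (fun M i => Function.update M i (firstVacant k (s i) M)) (fun _ => none)

/-- Estimated utilities: those of the candidates outside the advantaged group `G₁` are
multiplied by the bias parameter `β`. -/
def estimated (G₁ : Finset (Fin n)) (β : ℝ) (u : Fin n → ℝ) : Fin n → ℝ :=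
  fun i => if i ∈ G₁ then u i else β * u i

/-- The uniform distribution on `[0,1]`. -/
def uniform01 : Measure ℝ := volume.restrict (Set.Icc 0 1)

/-- The joint law of latent utilities and preference lists of `n` candidates: the utilities are
i.i.d. with law `D`, the lists are i.i.d. with law `L`, and both families are independent. -/
def law (n : ℕ) {p : ℕ} (D : Measure ℝ) (L : Measure (PrefList p)) :
    Measure ((Fin n → ℝ) × (Fin n → PrefList p)) :=
  (Measure.pi (fun _ : Fin n => D)).prod (Measure.pi (fun _ : Fin n => L))

/-- The fraction of the members of `G` that belong to `S`. -/
def frac (S G : Finset (Fin n)) : ℝ := ((S ∩ G).card : ℝ) / (G.card : ℝ)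

/-- The ratio of the smaller to the larger of the fractions of `G₁` and of its complement `G₂`
that belong to `S`. -/
def groupRatio (G₁ S : Finset (Fin n)) : ℝ :=
  min (frac S G₁) (frac S G₁ᶜ) / max (frac S G₁) (frac S G₁ᶜ)

/-- Ratio of the selection rates of the two groups, for latent utilities and lists `w`. -/
def repRatio (A : Algorithm n p) (G₁ : Finset (Fin n)) (β : ℝ)
    (w : (Fin n → ℝ) × (Fin n → PrefList p)) : ℝ :=
  groupRatio G₁ (selected (A (estimated G₁ β w.1) w.2))

/-- Ratio of the rates at which the two groups get their first choice. -/
def prefRatio (A : Algorithm n p) (G₁ : Finset (Fin n)) (β : ℝ)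
    (w : (Fin n → ℝ) × (Fin n → PrefList p)) : ℝ :=
  groupRatio G₁ (gotFirst w.2 (A (estimated G₁ β w.1) w.2))

/-- Latent utility of the selection over the sum of the top `∑ k` latent utilities. -/
def utilRatio (k : Fin p → ℕ) (A : Algorithm n p) (G₁ : Finset (Fin n)) (β : ℝ)
    (w : (Fin n → ℝ) × (Fin n → PrefList p)) : ℝ :=
  utility w.1 (A (estimated G₁ β w.1) w.2) / topSum (∑ l, k l) w.1

/-- Representational fairness. -/
def repFairness (D : Measure ℝ) (L : Measure (PrefList p)) (A : Algorithm n p)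
    (G₁ : Finset (Fin n)) (β : ℝ) : ℝ :=
  ∫ w, repRatio A G₁ β w ∂(law n D L)

/-- Preference-based fairness. -/
def prefFairness (D : Measure ℝ) (L : Measure (PrefList p)) (A : Algorithm n p)
    (G₁ : Finset (Fin n)) (β : ℝ) : ℝ :=
  ∫ w, prefRatio A G₁ β w ∂(law n D L)

/-- The utility ratio. -/
def utilityRatio (D : Measure ℝ) (L : Measure (PrefList p)) (k : Fin p → ℕ) (A : Algorithm n p)
    (G₁ : Finset (Fin n)) (β : ℝ) : ℝ :=
  ∫ w, utilRatio k A G₁ β w ∂(law n D L)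

/-- `f(x,y) = x - x(x+1)/(2(y+1))`. -/
def topMean (x y : ℝ) : ℝ := x - x * (x + 1) / (2 * (y + 1))

/-- `α₁`. -/
def alphaOne (n₁ n₂ K β : ℝ) : ℝ :=
  K - n₂ / (β * n₁ + n₂) * max (K - (1 - β) * n₁) 0

/-- `α₂ = K - α₁`. -/
def alphaTwo (n₁ n₂ K β : ℝ) : ℝ := K - alphaOne n₁ n₂ K β

/-- The limiting fairness value `max {(K - n₁(1-β)) / (Kβ + n₂(1-β)), 0}`. -/
def fairValue (n₁ n₂ K β : ℝ) : ℝ :=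
  max ((K - n₁ * (1 - β)) / (K * β + n₂ * (1 - β))) 0

end CentralSelection

end

open CentralSelection

/-! All three bounds come out without `√log n` and without the factor `p`; the stated forms follow
because both groups are nonempty, so `n ≥ 2`, and `K > 0` forces `p ≥ 1`.

Selection. Almost surely the estimated utilities are positive and distinct, so every maximizing
algorithm selects exactly the top `K` candidates (`isTop_selected_of_maximal`), whatever the lists
are. Choose rates with `n₁r₁ + n₂r₂ = K` such that `1 - r₁` for `G₁` and `1 - r₂` for `G₂` describe
one cut of the estimated utilities (`exists_rates`); then `v = r₂ / r₁`. The set above this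
deterministic cut is nested with the top `K` set, so exchanging them costs at most the deviation of
a count from its mean, which is at most of order `√n` in `L¹` by a variance bound
(`IsTop.abs_card_sub_le`). This gives the selection and the utility statements.

First choices. The point is that the set `F` of those who get their first choice is, in the mean, no
more balanced than the set `S` of those selected. The group ratio is at most a capped ratio `min 1
(c |F ∩ G₂| / |F ∩ G₁|)`. Estimated utilities are uniform on a box, so given their values up to
relabelling, `G₂` is a uniformly random `n₂`-subset `H` of `D = {x ≤ β}`
(`integral_estimated_nonneg`), and one may average over `H`. If some estimated utility exceeds `β`,
the top candidate lies in `G₁` and surely gets its first choice. This sure member turns the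
denominators into `1 + N`, and for such ratios the removal of a random element does not help in the
mean (`sum_cappedRatioSucc_erase_le`). Hence the mean over a random thinning increases with the
retention probability (`thinMean_mono`). In the stable algorithm the chance of finding the first
choice open only decreases as slots fill, so by induction the process is dominated by thinning with
a constant probability, and that by no thinning at all, which is `S`
(`integral_firstChoosers_le_thinMean`, `sum_integral_cappedRatio_le`).

The exceptional event, all of `G₁` below `β`, has probability `β ^ n₁` and costs only `(1 - v) β ^
n₁ = O(1 / (η₁ η₂ n))`. -/

open MeasureTheory CentralSelection

namespace CentralSelection

/-! ### Sorted lists, top sets and super-level sets. -/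

section Sorting

variable {n : ℕ}

lemma byDecreasing_perm (x : Fin n → ℝ) : (byDecreasing x).Perm (List.finRange n) :=
  List.perm_insertionSort _ _

lemma byDecreasing_length (x : Fin n → ℝ) : (byDecreasing x).length = n := by
  simpa using (byDecreasing_perm x).length_eq

lemma byDecreasing_nodup (x : Fin n → ℝ) : (byDecreasing x).Nodup :=
  (byDecreasing_perm x).nodup_iff.2 (List.nodup_finRange n)

lemma mem_byDecreasing (x : Fin n → ℝ) (i : Fin n) : i ∈ byDecreasing x :=
  (byDecreasing_perm x).mem_iff.2 (List.mem_finRange i)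

lemma byDecreasing_pairwise (x : Fin n → ℝ) :
    (byDecreasing x).Pairwise (fun i j => x j ≤ x i) := by
  have : Std.Total (fun i j : Fin n => x j ≤ x i) := ⟨fun i j => le_total _ _⟩
  have : IsTrans (Fin n) (fun i j : Fin n => x j ≤ x i) := ⟨fun i j k h h' => le_trans h' h⟩
  exact List.pairwise_insertionSort _ _

/-- Without ties the decreasing order is unique. Injectivity matters: ties are broken by index,
which is not equivariant. -/
lemma byDecreasing_comp_perm (x : Fin n → ℝ) (hx : Function.Injective x)
    (e : Equiv.Perm (Fin n)) :
    byDecreasing (x ∘ e) = (byDecreasing x).map e.symm := by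
  have hp : (byDecreasing (x ∘ e)).Perm ((byDecreasing x).map e.symm) := by
    rw [List.perm_ext_iff_of_nodup (byDecreasing_nodup _)
      ((byDecreasing_nodup x).map e.symm.injective)]
    intro a
    simp only [mem_byDecreasing, true_iff, List.mem_map]
    exact ⟨e a, trivial, by simp⟩
  refine hp.eq_of_pairwise (le := fun i j => x (e j) ≤ x (e i)) ?_
    (byDecreasing_pairwise (x ∘ e)) ?_
  · intro a b _ _ h1 h2
    exact e.injective (hx (le_antisymm h2 h1))
  · rw [List.pairwise_map]
    simpa using byDecreasing_pairwise x

/-- The `K` candidates with the largest values. -/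
noncomputable def topSet (K : ℕ) (x : Fin n → ℝ) : Finset (Fin n) :=
  ((byDecreasing x).take K).toFinset

/-- `S` consists of `K` candidates whose values are at least those of all others. -/
def IsTop (K : ℕ) (x : Fin n → ℝ) (S : Finset (Fin n)) : Prop :=
  S.card = K ∧ ∀ i ∈ S, ∀ j ∉ S, x j ≤ x i

lemma isTop_topSet {K : ℕ} (hK : K ≤ n) (x : Fin n → ℝ) : IsTop K x (topSet K x) := by
  constructor
  · rw [topSet,
      List.toFinset_card_of_nodup ((byDecreasing_nodup x).sublist (List.take_sublist _ _)),
      List.length_take, byDecreasing_length, min_eq_left hK]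
  · intro i hi j hj
    have h := byDecreasing_pairwise x
    rw [← List.take_append_drop K (byDecreasing x), List.pairwise_append] at h
    refine h.2.2 i (List.mem_toFinset.1 hi) j ?_
    have := mem_byDecreasing x j
    rw [← List.take_append_drop K (byDecreasing x), List.mem_append] at this
    exact this.resolve_left fun h' => hj (List.mem_toFinset.2 h')

lemma IsTop.eq {K : ℕ} {x : Fin n → ℝ} (hx : Function.Injective x) {S T : Finset (Fin n)}
    (hS : IsTop K x S) (hT : IsTop K x T) : S = T := by
  by_contra hne
  have h1 : ¬ S ⊆ T := fun h => hne (Finset.eq_of_subset_of_card_le h (by rw [hS.1, hT.1]))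
  have h2 : ¬ T ⊆ S := fun h => hne (Finset.eq_of_subset_of_card_le h (by rw [hS.1, hT.1])).symm
  obtain ⟨i, hi, hi'⟩ := Finset.not_subset.1 h1
  obtain ⟨j, hj, hj'⟩ := Finset.not_subset.1 h2
  have := hx (le_antisymm (hS.2 i hi j hj') (hT.2 j hj i hi'))
  exact hj' (this ▸ hi)

lemma topSum_eq_sum (K : ℕ) (x : Fin n → ℝ) : topSum K x = ∑ i ∈ topSet K x, x i :=
  (List.sum_toFinset x ((byDecreasing_nodup x).sublist (List.take_sublist _ _))).symm

lemma IsTop.sum_le {K : ℕ} {x : Fin n → ℝ} (hx : ∀ i, 0 ≤ x i) {S T : Finset (Fin n)}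
    (hS : IsTop K x S) (hT : T.card ≤ K) : ∑ i ∈ T, x i ≤ ∑ i ∈ S, x i := by
  rw [← Finset.sum_inter_add_sum_sdiff T S, ← Finset.sum_inter_add_sum_sdiff S T,
    Finset.inter_comm T S]
  have hc : (T \ S).card ≤ (S \ T).card := by
    have h1 := Finset.card_sdiff_add_card_inter T S
    have h2 := Finset.card_sdiff_add_card_inter S T
    rw [Finset.inter_comm] at h2
    have := hS.1
    omega
  gcongr _ + ?_
  rcases (S \ T).eq_empty_or_nonempty with h | h
  · have : T \ S = ∅ := by
      rw [← Finset.card_eq_zero]; rw [h] at hc; simpa using hc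
    simp [h, this]
  · obtain ⟨i₀, hi₀, hmin⟩ := Finset.exists_min_image (S \ T) x h
    calc ∑ i ∈ T \ S, x i ≤ (T \ S).card • x i₀ := by
          refine Finset.sum_le_card_nsmul _ _ _ fun j hj => ?_
          exact hS.2 _ (Finset.mem_sdiff.1 hi₀).1 _ (Finset.mem_sdiff.1 hj).2
      _ ≤ (S \ T).card • x i₀ := nsmul_le_nsmul_left (hx _) hc
      _ ≤ ∑ i ∈ S \ T, x i := Finset.card_nsmul_le_sum _ _ _ hmin

/-- A top set and a super-level set are nested, so that sums of weights in `[0,1]` over them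
differ by at most the difference of their sizes. -/
lemma IsTop.abs_sum_sub_le {K : ℕ} {x : Fin n → ℝ} {S : Finset (Fin n)} (hS : IsTop K x S)
    (t : ℝ) (w : Fin n → ℝ) (hw0 : ∀ i, 0 ≤ w i) (hw1 : ∀ i, w i ≤ 1) :
    |∑ i ∈ S, w i - ∑ i ∈ Finset.univ.filter (fun i => t < x i), w i| ≤
      |(K : ℝ) - ((Finset.univ.filter (fun i => t < x i)).card : ℝ)| := by
  set Q := Finset.univ.filter (fun i => t < x i) with hQ
  have key : ∀ A B : Finset (Fin n), A ⊆ B →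
      |∑ i ∈ B, w i - ∑ i ∈ A, w i| ≤ |(B.card : ℝ) - A.card| := by
    intro A B h
    have h1 := Finset.sum_sdiff (f := w) h
    have h2 := Finset.card_sdiff_add_card_eq_card h
    have h3 : ∑ i ∈ B, w i - ∑ i ∈ A, w i = ∑ i ∈ B \ A, w i := by linarith
    have h4 : (B.card : ℝ) - A.card = (B \ A).card := by rw [← h2]; push_cast; ring
    rw [h3, h4, abs_of_nonneg (Finset.sum_nonneg fun i _ => hw0 i),
      abs_of_nonneg (Nat.cast_nonneg _)]
    simpa using Finset.sum_le_card_nsmul (B \ A) w 1 fun i _ => hw1 i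
  rw [← hS.1]
  by_cases h : S ⊆ Q
  · rw [abs_sub_comm, abs_sub_comm (S.card : ℝ)]; exact key _ _ h
  -- Some member of `S` has value at most `t`, hence so has everything outside `S`: thus `Q ⊆ S`.
  · refine key _ _ fun j hj => ?_
    by_contra hjS
    obtain ⟨i, hi, hi'⟩ := Finset.not_subset.1 h
    have h1 := hS.2 i hi j hjS
    simp only [hQ, Finset.mem_filter, Finset.mem_univ, true_and, not_lt] at hj hi'
    linarith

end Sorting

/-! ### Utility maximizers are top sets. -/

section Maximizing

variable {n p : ℕ}

lemma card_selected (M : Assignment n p) :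
    (selected M).card = ∑ l, (assignedTo M l).card := by
  have : selected M = Finset.univ.biUnion (fun l => assignedTo M l) := by
    ext i
    simp [selected, assignedTo, Option.ne_none_iff_exists']
  rw [this, Finset.card_biUnion]
  intro a _ b _ hab
  refine Finset.disjoint_left.2 fun i hi hi' => hab ?_
  simp only [assignedTo, Finset.mem_filter, Finset.mem_univ, true_and] at hi hi'
  rw [hi] at hi'
  exact Option.some_injective _ hi'

lemma assignedTo_update_some (M : Assignment n p) (i : Fin n) (hi : M i = none) (l l' : Fin p) :
    assignedTo (Function.update M i (some l)) l' =
      if l' = l then insert i (assignedTo M l') else assignedTo M l' := by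
  ext j
  by_cases hj : j = i
  · subst hj
    by_cases h : l' = l
    · simp [assignedTo, h]
    · simp [assignedTo, h, hi, Ne.symm h]
  · by_cases h : l' = l <;> simp [assignedTo, h, hj]

lemma selected_update_some (M : Assignment n p) (i : Fin n) (l : Fin p) :
    selected (Function.update M i (some l)) = insert i (selected M) := by
  ext j
  by_cases hj : j = i
  · subst hj; simp [selected]
  · simp [selected, hj]

/-- A selection maximizing a positive utility consists of `K` candidates of largest utility. -/
lemma isTop_selected_of_maximal {k : Fin p → ℕ} (hK : ∑ l, k l ≤ n) {x : Fin n → ℝ}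
    (hx : ∀ i, 0 < x i) {M : Assignment n p} (hM : Feasible k M)
    (hmax : ∀ M' : Assignment n p, Feasible k M' → utility x M' ≤ utility x M) :
    IsTop (∑ l, k l) x (selected M) := by
  constructor
  · refine le_antisymm ?_ ?_
    · rw [card_selected]; exact Finset.sum_le_sum fun l _ => hM l
    · by_contra! hlt
      obtain ⟨l, -, hl⟩ : ∃ l ∈ Finset.univ, (assignedTo M l).card < k l := by
        rw [card_selected] at hlt
        exact Finset.exists_lt_of_sum_lt hlt
      -- An unselected candidate exists because `K ≤ n`; putting it into the free slot gains its
      -- positive utility.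
      obtain ⟨i, hi⟩ : ∃ i, i ∉ selected M := by
        by_contra! h
        have : selected M = Finset.univ := Finset.eq_univ_iff_forall.2 h
        rw [this, Finset.card_univ, Fintype.card_fin] at hlt
        omega
      have hi' : M i = none := by simpa [selected] using hi
      have := hmax (Function.update M i (some l)) fun l' => by
        rw [assignedTo_update_some _ _ hi']
        split_ifs with h
        · subst h
          exact (Finset.card_insert_le _ _).trans hl
        · exact hM l'
      rw [utility, utility, selected_update_some, Finset.sum_insert hi] at this
      linarith [hx i]
  · intro i hi j hj
    by_contra! hlt
    have hj' : M j = none := by simpa [selected] using hj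
    have hij : i ≠ j := fun h => hj (h ▸ hi)
    -- Exchange argument: `j` takes over the slot of `i`, so all loads are unchanged.
    let M' : Assignment n p := M ∘ Equiv.swap i j
    have hM' : Feasible k M' := fun l => by
      have : assignedTo M' l = (assignedTo M l).map (Equiv.swap i j).toEmbedding := by
        ext a
        simp [assignedTo, M', Finset.mem_map_equiv]
      rw [this, Finset.card_map]
      exact hM l
    have := hmax M' hM'
    have hsel : selected M' = insert j ((selected M).erase i) := by
      ext a
      simp only [selected, M', Function.comp, Finset.mem_filter, Finset.mem_univ, true_and,
        Finset.mem_insert, Finset.mem_erase]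
      rcases eq_or_ne a i with rfl | hai
      · simp [hj', hij]
      · rcases eq_or_ne a j with rfl | haj
        · simpa [selected] using hi
        · simp [Equiv.swap_apply_of_ne_of_ne hai haj, hai, haj]
    rw [utility, utility, hsel, Finset.sum_insert (by simp [hj]),
      ← Finset.add_sum_erase _ x hi] at this
    linarith

end Maximizing

/-! ### Independent thinning of a finite set and its monotonicity. -/

section RandomSubset

variable {ι : Type*} [DecidableEq ι]

/-- The mean of `g` over the random subset of `P` that contains each element independently with
probability `q`. -/
def thinMean (P : Finset ι) (g : Finset ι → ℝ) (q : ℝ) : ℝ :=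
  ∑ B ∈ P.powerset, q ^ B.card * (1 - q) ^ (P \ B).card * g B

lemma thinMean_empty (g : Finset ι → ℝ) (q : ℝ) : thinMean ∅ g q = g ∅ := by
  simp [thinMean]

lemma thinMean_one (P : Finset ι) (g : Finset ι → ℝ) : thinMean P g 1 = g P := by
  rw [thinMean, Finset.sum_eq_single P]
  · simp
  · intro B hB hne
    have : (P \ B).card ≠ 0 := by
      rw [Finset.card_ne_zero, Finset.sdiff_nonempty]
      exact fun h => hne (Finset.Subset.antisymm (Finset.mem_powerset.1 hB) h)
    simp [zero_pow this]
  · simp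

/-- Conditioning on whether `i` is retained; it mirrors one step of the stable algorithm. -/
lemma thinMean_insert {P : Finset ι} {i : ι} (hi : i ∉ P) (g : Finset ι → ℝ) (q : ℝ) :
    thinMean (insert i P) g q =
      (1 - q) * thinMean P g q + q * thinMean P (fun B => g (insert i B)) q := by
  rw [thinMean, Finset.sum_powerset_insert hi, thinMean, thinMean, Finset.mul_sum, Finset.mul_sum]
  congr 1 <;> refine Finset.sum_congr rfl fun B hB => ?_
  · have hB' := Finset.mem_powerset.1 hB
    have : i ∉ B := fun h => hi (hB' h)
    rw [Finset.insert_sdiff_of_notMem _ this, Finset.card_insert_of_notMem (by simp [hi])]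
    ring
  · have hB' := Finset.mem_powerset.1 hB
    have : i ∉ B := fun h => hi (hB' h)
    have h2 : insert i P \ insert i B = P \ B := by
      ext j
      by_cases hj : j = i
      · subst hj; simp [hi]
      · simp [hj]
    rw [h2, Finset.card_insert_of_notMem this]
    ring

/-- If the average of `g` over the subsets of `B` with one element less is at most `g B`,
then the mean of `g` over random subsets increases with the inclusion probability. -/
lemma thinMean_mono {P : Finset ι} {g : Finset ι → ℝ}
    (hg : ∀ B ⊆ P, ∑ j ∈ B, g (B.erase j) ≤ B.card * g B) {q q' : ℝ} (h0 : 0 ≤ q')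
    (hqq : q' ≤ q) (h1 : q ≤ 1) : thinMean P g q' ≤ thinMean P g q := by
  have hderiv : ∀ t : ℝ, HasDerivAt (thinMean P g)
      (∑ B ∈ P.powerset, ((B.card : ℝ) * t ^ (B.card - 1) * (1 - t) ^ (P \ B).card * g B -
        t ^ B.card * (((P \ B).card : ℝ) * (1 - t) ^ ((P \ B).card - 1)) * g B)) t := by
    intro t
    unfold thinMean
    refine HasDerivAt.fun_sum fun B _ => ?_
    have h1 := hasDerivAt_pow B.card t
    have h2 := ((hasDerivAt_id' t).const_sub 1).fun_pow (P \ B).card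
    refine ((h1.mul h2).mul_const (g B)).congr_deriv ?_
    ring
  have hmain : ∀ t : ℝ, 0 ≤ t → t ≤ 1 →
      0 ≤ ∑ B ∈ P.powerset, ((B.card : ℝ) * t ^ (B.card - 1) * (1 - t) ^ (P \ B).card * g B -
        t ^ B.card * (((P \ B).card : ℝ) * (1 - t) ^ ((P \ B).card - 1)) * g B) := by
    intro t ht0 ht1
    -- Reindexing `(B, j)` with `j ∉ B` by `(B ∪ {j}, j)` puts the negative terms over the same sets
    -- as the positive ones. The derivative becomes a nonnegative combination of `|B| g(B) - ∑ g(B \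
    -- j)`.
    have hswap : ∑ B ∈ P.powerset,
          t ^ B.card * (((P \ B).card : ℝ) * (1 - t) ^ ((P \ B).card - 1)) * g B =
        ∑ B ∈ P.powerset, t ^ (B.card - 1) * (1 - t) ^ (P \ B).card * ∑ j ∈ B, g (B.erase j) := by
      have e1 : ∀ B ∈ P.powerset,
          t ^ B.card * (((P \ B).card : ℝ) * (1 - t) ^ ((P \ B).card - 1)) * g B =
          ∑ j ∈ P \ B, t ^ B.card * (1 - t) ^ ((P \ B).card - 1) * g B := by
        intro B _
        rw [Finset.sum_const, nsmul_eq_mul]; ring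
      rw [Finset.sum_congr rfl e1]
      simp_rw [Finset.mul_sum]
      rw [Finset.sum_sigma', Finset.sum_sigma']
      refine Finset.sum_bij' (fun x _ => ⟨insert x.2 x.1, x.2⟩) (fun x _ => ⟨x.1.erase x.2, x.2⟩)
        ?_ ?_ ?_ ?_ ?_
      · rintro ⟨B, j⟩ h
        simp only [Finset.mem_sigma, Finset.mem_powerset, Finset.mem_sdiff] at h ⊢
        exact ⟨Finset.insert_subset h.2.1 h.1, Finset.mem_insert_self _ _⟩
      · rintro ⟨B, j⟩ h
        simp only [Finset.mem_sigma, Finset.mem_powerset, Finset.mem_sdiff] at h ⊢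
        exact ⟨(Finset.erase_subset _ _).trans h.1, h.1 h.2, by simp⟩
      · rintro ⟨B, j⟩ h
        simp only [Finset.mem_sigma, Finset.mem_powerset, Finset.mem_sdiff] at h
        simp [Finset.erase_insert h.2.2]
      · rintro ⟨B, j⟩ h
        simp only [Finset.mem_sigma, Finset.mem_powerset] at h
        simp [Finset.insert_erase h.2]
      · rintro ⟨B, j⟩ h
        simp only [Finset.mem_sigma, Finset.mem_powerset, Finset.mem_sdiff] at h
        have h2 : P \ insert j B = (P \ B).erase j := by
          ext a; simp only [Finset.mem_sdiff, Finset.mem_insert, Finset.mem_erase]; tauto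
        simp only
        rw [Finset.card_insert_of_notMem h.2.2, Finset.erase_insert h.2.2, h2,
          Finset.card_erase_of_mem (by simp [h.2])]
        simp
    rw [Finset.sum_sub_distrib, hswap, ← Finset.sum_sub_distrib]
    refine Finset.sum_nonneg fun B hB => ?_
    have h := hg B (Finset.mem_powerset.1 hB)
    have h3 : 0 ≤ t ^ (B.card - 1) * (1 - t) ^ (P \ B).card :=
      mul_nonneg (pow_nonneg ht0 _) (pow_nonneg (by linarith) _)
    nlinarith [mul_nonneg h3 (sub_nonneg.2 h)]
  have hmono : MonotoneOn (thinMean P g) (Set.Icc 0 1) := by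
    refine monotoneOn_of_deriv_nonneg (convex_Icc 0 1)
      (fun t _ => (hderiv t).continuousAt.continuousWithinAt)
      (fun t _ => (hderiv t).differentiableAt.differentiableWithinAt) fun t ht => ?_
    rw [(hderiv t).deriv]
    rw [interior_Icc] at ht
    exact hmain t ht.1.le ht.2.le
  exact hmono ⟨h0, hqq.trans h1⟩ ⟨h0.trans hqq, h1⟩ hqq

end RandomSubset

/-! ### The stable algorithm: who gets a first choice. -/

section StableAlgorithm

variable {n p : ℕ}

/-- The most preferred institution of the list `s` has a vacant slot. -/
def FirstOpen (k : Fin p → ℕ) (M : Assignment n p) (s : PrefList p) : Prop :=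
  ∃ r : Fin p, (r : ℕ) = 0 ∧ (assignedTo M (s r)).card < k (s r)

/-- One step of the stable assignment algorithm. -/
noncomputable def stableStep (k : Fin p → ℕ) (s : Fin n → PrefList p) (M : Assignment n p)
    (i : Fin n) : Assignment n p :=
  Function.update M i (firstVacant k (s i) M)

open Classical in
/-- The candidates who get their first choice when the candidates of a list are processed in turn,
starting with the partial selection `M`. -/
noncomputable def firstChoosers (k : Fin p → ℕ) (s : Fin n → PrefList p) :
    List (Fin n) → Assignment n p → Finset (Fin n)
  | [], _ => ∅
  | i :: l, M => (if FirstOpen k M (s i) then {i} else ∅) ∪ firstChoosers k s l (stableStep k s M i)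

lemma firstVacant_eq_first_iff (k : Fin p → ℕ) (s : PrefList p) (M : Assignment n p) :
    (∃ r : Fin p, (r : ℕ) = 0 ∧ firstVacant k s M = some (s r)) ↔ FirstOpen k M s := by
  unfold FirstOpen firstVacant
  cases p with
  | zero => simp
  | succ p =>
    refine exists_congr fun r => and_congr_right fun hr => ?_
    have hr' : r = 0 := Fin.ext hr
    subst hr'
    rw [List.ofFn_succ, List.find?_cons]
    by_cases h : (assignedTo M (s 0)).card < k (s 0)
    · simp [h]
    · simp only [h, decide_false, iff_false]
      intro h'
      have := List.find?_some h'
      simp [h] at this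

lemma firstVacant_vacant {k : Fin p → ℕ} {s : PrefList p} {M : Assignment n p} {l : Fin p}
    (h : firstVacant k s M = some l) : (assignedTo M l).card < k l := by
  simpa using List.find?_some h

lemma firstVacant_eq_none {k : Fin p → ℕ} {s : PrefList p} {M : Assignment n p}
    (h : firstVacant k s M = none) (l : Fin p) : k l ≤ (assignedTo M l).card := by
  have := (List.find?_eq_none.1 h) l (by simp [List.mem_ofFn, s.surjective l])
  simpa using this

lemma stableStep_of_ne (k : Fin p → ℕ) (s : Fin n → PrefList p) (M : Assignment n p)
    {i j : Fin n} (h : j ≠ i) : stableStep k s M i j = M j :=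
  Function.update_of_ne h _ _

lemma stableStep_eq_of_eq_none (k : Fin p → ℕ) (s : Fin n → PrefList p) {M : Assignment n p}
    {i : Fin n} (hi : M i = none) (h : firstVacant k (s i) M = none) : stableStep k s M i = M := by
  rw [stableStep, h, ← hi, Function.update_eq_self]

lemma assignedTo_subset_stableStep (k : Fin p → ℕ) (s : Fin n → PrefList p) {M : Assignment n p}
    {i : Fin n} (hi : M i = none) (l : Fin p) :
    assignedTo M l ⊆ assignedTo (stableStep k s M i) l := by
  intro j hj
  have hj' : M j = some l := by simpa [assignedTo] using hj
  have : j ≠ i := fun h => by simp [h, hi] at hj'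
  simp [assignedTo, stableStep_of_ne k s M this, hj']

lemma FirstOpen.of_stableStep {k : Fin p → ℕ} {s : Fin n → PrefList p} {M : Assignment n p}
    {i : Fin n} (hi : M i = none) {t : PrefList p} (h : FirstOpen k (stableStep k s M i) t) :
    FirstOpen k M t := by
  obtain ⟨r, hr, h⟩ := h
  exact ⟨r, hr, (Finset.card_le_card (assignedTo_subset_stableStep k s hi _)).trans_lt h⟩

lemma mem_gotFirst (s : Fin n → PrefList p) (M : Assignment n p) (i : Fin n) :
    i ∈ gotFirst s M ↔ ∃ r : Fin p, (r : ℕ) = 0 ∧ M i = some (s i r) := by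
  simp [gotFirst]

lemma gotFirst_foldl (k : Fin p → ℕ) (s : Fin n → PrefList p) (l : List (Fin n)) (hl : l.Nodup)
    (M : Assignment n p) (hM : ∀ i ∈ l, M i = none) :
    gotFirst s (l.foldl (stableStep k s) M) = gotFirst s M ∪ firstChoosers k s l M := by
  classical
  induction l generalizing M with
  | nil => simp [firstChoosers]
  | cons i l ih =>
    rw [List.nodup_cons] at hl
    have hi : M i = none := hM i (by simp)
    rw [List.foldl_cons, ih hl.2, firstChoosers, ← Finset.union_assoc]
    · congr 1
      ext j
      by_cases hj : j = i
      · subst hj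
        have := firstVacant_eq_first_iff k (s j) M
        rw [mem_gotFirst, stableStep, Function.update_self, this, Finset.mem_union, mem_gotFirst]
        by_cases ho : FirstOpen k M (s j) <;> simp [ho, hi]
      · rw [mem_gotFirst, stableStep_of_ne k s M hj, Finset.mem_union, mem_gotFirst]
        by_cases ho : FirstOpen k M (s i) <;> simp [ho, hj]
    · intro j hj
      have : j ≠ i := fun h => hl.1 (h ▸ hj)
      rw [stableStep_of_ne k s M this]
      exact hM j (by simp [hj])

lemma gotFirst_stableAlg (k : Fin p → ℕ) (x : Fin n → ℝ) (s : Fin n → PrefList p) :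
    gotFirst s (stableAlg k x s) = firstChoosers k s (byDecreasing x) (fun _ => none) := by
  have := gotFirst_foldl k s (byDecreasing x) (byDecreasing_nodup x) (fun _ => none) (by simp)
  rw [show gotFirst s (fun _ : Fin n => (none : Option (Fin p))) = ∅ by simp [gotFirst],
    Finset.empty_union] at this
  exact this

lemma firstChoosers_append (k : Fin p → ℕ) (s : Fin n → PrefList p) (l l' : List (Fin n))
    (M : Assignment n p) :
    firstChoosers k s (l ++ l') M =
      firstChoosers k s l M ∪ firstChoosers k s l' (l.foldl (stableStep k s) M) := by
  induction l generalizing M with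
  | nil => simp [firstChoosers]
  | cons i l ih => simp [firstChoosers, ih, Finset.union_assoc]

lemma firstChoosers_subset (k : Fin p → ℕ) (s : Fin n → PrefList p) (l : List (Fin n))
    (M : Assignment n p) : firstChoosers k s l M ⊆ l.toFinset := by
  induction l generalizing M with
  | nil => simp [firstChoosers]
  | cons i l ih =>
    rw [firstChoosers, List.toFinset_cons, Finset.insert_eq]
    refine Finset.union_subset_union ?_ (ih _)
    split_ifs <;> simp

lemma firstChoosers_eq_empty_of_full {k : Fin p → ℕ} {s : Fin n → PrefList p} {l : List (Fin n)}
    (hl : l.Nodup) {M : Assignment n p} (hM : ∀ i ∈ l, M i = none)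
    (hfull : ∀ a, k a ≤ (assignedTo M a).card) : firstChoosers k s l M = ∅ := by
  induction l generalizing M with
  | nil => rfl
  | cons i l ih =>
    rw [List.nodup_cons] at hl
    rw [firstChoosers, if_neg, Finset.empty_union]
    · refine ih hl.2 (fun j hj => ?_) fun a => (hfull a).trans
        (Finset.card_le_card (assignedTo_subset_stableStep k s (hM i (by simp)) a))
      rw [stableStep_of_ne k s M (ne_of_mem_of_not_mem hj hl.1)]
      exact hM j (by simp [hj])
    · rintro ⟨r, -, hr⟩
      exact (hfull _).not_gt hr

lemma Feasible.stableStep {k : Fin p → ℕ} {s : Fin n → PrefList p} {M : Assignment n p}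
    (hM : Feasible k M) {i : Fin n} (hi : M i = none) : Feasible k (stableStep k s M i) := by
  cases h : firstVacant k (s i) M with
  | none => rwa [stableStep_eq_of_eq_none k s hi h]
  | some l =>
    intro l'
    rw [CentralSelection.stableStep, h, assignedTo_update_some _ _ hi]
    split_ifs with h'
    · subst h'
      exact (Finset.card_insert_le _ _).trans (firstVacant_vacant h)
    · exact hM l'

/-- Each step either fills a slot or finds all slots full, so `K` steps from the empty selection
fill everything. -/
lemma card_selected_foldl {k : Fin p → ℕ} (s : Fin n → PrefList p) {l : List (Fin n)}
    (hl : l.Nodup) {M : Assignment n p} (hM : ∀ i ∈ l, M i = none) (hf : Feasible k M) :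
    Feasible k (l.foldl (stableStep k s) M) ∧
      min (∑ a, k a) ((selected M).card + l.length) ≤
        (selected (l.foldl (stableStep k s) M)).card := by
  induction l generalizing M with
  | nil => exact ⟨hf, by simp⟩
  | cons i l ih =>
    rw [List.nodup_cons] at hl
    have hi := hM i (by simp)
    have := ih (M := stableStep k s M i) hl.2 (fun j hj => by
      rw [stableStep_of_ne k s M (ne_of_mem_of_not_mem hj hl.1)]
      exact hM j (by simp [hj])) (hf.stableStep hi)
    refine ⟨this.1, le_trans ?_ this.2⟩
    cases h : firstVacant k (s i) M with
    | none =>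
      rw [stableStep_eq_of_eq_none k s hi h]
      refine le_min (min_le_left _ _) ((min_le_left _ _).trans ?_)
      rw [card_selected]
      exact (Finset.sum_le_sum fun a _ => firstVacant_eq_none h a).trans (Nat.le_add_right _ _)
    | some a =>
      have hi' : i ∉ selected M := by simp [selected, hi]
      rw [stableStep, h, selected_update_some, Finset.card_insert_of_notMem hi', List.length_cons]
      rw [Nat.add_right_comm, Nat.add_assoc]

/-- After the top `K` candidates no vacancy is left. This confines the first choosers to the top set
with which they are to be compared. -/
lemma firstChoosers_byDecreasing (k : Fin p → ℕ) (hK : ∑ a, k a ≤ n) (s : Fin n → PrefList p)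
    (x : Fin n → ℝ) :
    firstChoosers k s (byDecreasing x) (fun _ => none) =
      firstChoosers k s ((byDecreasing x).take (∑ a, k a)) (fun _ => none) := by
  have hnd := byDecreasing_nodup x
  rw [← List.take_append_drop (∑ a, k a) (byDecreasing x)] at hnd
  conv_lhs => rw [← List.take_append_drop (∑ a, k a) (byDecreasing x)]
  rw [firstChoosers_append]
  rw [List.nodup_append'] at hnd
  obtain ⟨h1, h2, h3⟩ := hnd
  have hF : Feasible k (fun _ : Fin n => (none : Option (Fin p))) := fun l => by
    simp [assignedTo]
  obtain ⟨hf, hc⟩ := card_selected_foldl (k := k) s h1 (M := fun _ => none) (by simp) hF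
  rw [firstChoosers_eq_empty_of_full h2, Finset.union_empty]
  · intro i hi
    have key : ∀ (l : List (Fin n)) (M : Assignment n p), i ∉ l → M i = none →
        l.foldl (stableStep k s) M i = none := by
      intro l
      induction l with
      | nil => intro M _ h; exact h
      | cons j l ih =>
        intro M hl h
        rw [List.mem_cons, not_or] at hl
        exact ih _ hl.2 (by rw [stableStep_of_ne k s M hl.1]; exact h)
    exact key _ _ (fun h => h3 h hi) rfl
  · rw [List.length_take, byDecreasing_length, min_eq_left hK,
      min_eq_left (Nat.le_add_left _ _), card_selected] at hc
    intro a
    by_contra! hlt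
    exact (Finset.sum_lt_sum (fun b _ => hf b) ⟨a, Finset.mem_univ a, hlt⟩).not_ge hc

lemma assignedTo_comp_perm (M : Assignment n p) (e : Equiv.Perm (Fin n)) (a : Fin p) :
    assignedTo (M ∘ e) a = (assignedTo M a).map e.symm.toEmbedding := by
  ext j
  simp [assignedTo, Finset.mem_map_equiv]

/-- The algorithm sees the current selection only through the loads of the institutions, which do
not depend on the names of the candidates. -/
lemma firstChoosers_map_perm (k : Fin p → ℕ) (s : Fin n → PrefList p) (e : Equiv.Perm (Fin n))
    (l : List (Fin n)) (M : Assignment n p) :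
    firstChoosers k (s ∘ e) (l.map e.symm) (M ∘ e) =
      (firstChoosers k s l M).map e.symm.toEmbedding := by
  induction l generalizing M with
  | nil => simp [firstChoosers]
  | cons i l ih =>
    have hcard : ∀ a, (assignedTo (M ∘ e) a).card = (assignedTo M a).card := fun a => by
      rw [assignedTo_comp_perm, Finset.card_map]
    have hstep : stableStep k (s ∘ e) (M ∘ e) (e.symm i) = stableStep k s M i ∘ e := by
      have : firstVacant k (s i) (M ∘ e) = firstVacant k (s i) M := by
        simp only [firstVacant, hcard]
      ext1 j
      by_cases hj : j = e.symm i
      · subst hj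
        simp [stableStep, this]
      · have hj' : e j ≠ i := fun h => hj (by simp [← h])
        simp [stableStep, Function.update_of_ne hj, Function.update_of_ne hj']
    rw [List.map_cons, firstChoosers, firstChoosers, hstep, ih, Finset.map_union]
    congr 1
    have hopen : FirstOpen k (M ∘ e) (s i) ↔ FirstOpen k M (s i) := by
      simp only [FirstOpen, hcard]
    by_cases h : FirstOpen k M (s i) <;> simp [hopen, h]

lemma firstChoosers_comp_perm (k : Fin p → ℕ) (s : Fin n → PrefList p) (e : Equiv.Perm (Fin n))
    {x : Fin n → ℝ} (hx : Function.Injective x) :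
    firstChoosers k (s ∘ e) (byDecreasing (x ∘ e)) (fun _ => none) =
      (firstChoosers k s (byDecreasing x) (fun _ => none)).map e.symm.toEmbedding := by
  rw [byDecreasing_comp_perm x hx]
  exact firstChoosers_map_perm k s e _ (fun _ => none)

end StableAlgorithm

/-! ### Random lists: domination of the process by thinning. -/

section Lists

variable {n p : ℕ} (L : Measure (PrefList p)) [IsProbabilityMeasure L]

lemma integrable_lists (g : (Fin n → PrefList p) → ℝ) :
    Integrable g (Measure.pi fun _ : Fin n => L) := Integrable.of_finite

/-- Resampling one coordinate does not change the law of the lists. -/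
lemma integral_update (i : Fin n) (g : (Fin n → PrefList p) → ℝ) :
    ∫ s, g s ∂(Measure.pi fun _ : Fin n => L) =
      ∫ t, ∫ s, g (Function.update s i t) ∂(Measure.pi fun _ : Fin n => L) ∂L := by
  have hmap : (L.prod (Measure.pi fun _ : Fin n => L)).map
      (fun z : PrefList p × (Fin n → PrefList p) => Function.update z.2 i z.1) =
        Measure.pi fun _ : Fin n => L := by
    refine (Measure.pi_eq fun A hA => ?_).symm
    rw [Measure.map_apply (measurable_of_finite _) (MeasurableSet.univ_pi hA)]
    have : (fun z : PrefList p × (Fin n → PrefList p) => Function.update z.2 i z.1) ⁻¹'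
        Set.univ.pi A = A i ×ˢ Set.univ.pi (Function.update A i Set.univ) := by
      ext ⟨t, s⟩
      simp only [Set.mem_preimage, Set.mem_pi, Set.mem_univ, true_implies, Set.mem_prod]
      constructor
      · intro h
        refine ⟨by simpa using h i, fun j => ?_⟩
        by_cases hj : j = i
        · subst hj; simp
        · simpa [Function.update_of_ne hj] using h j
      · rintro ⟨h1, h2⟩ j
        by_cases hj : j = i
        · subst hj; simpa using h1
        · simpa [Function.update_of_ne hj] using h2 j
    rw [this, Measure.prod_prod, Measure.pi_pi,
      ← Finset.mul_prod_erase _ _ (Finset.mem_univ i),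
      ← Finset.mul_prod_erase _ (fun j => L (A j)) (Finset.mem_univ i)]
    simp only [Function.update_self, measure_univ, one_mul]
    congr 1
    refine Finset.prod_congr rfl fun j hj => ?_
    rw [Function.update_of_ne (Finset.ne_of_mem_erase hj)]
  conv_lhs => rw [← hmap]
  rw [integral_map (measurable_of_finite _).aemeasurable
    (measurable_of_finite _).aestronglyMeasurable, integral_prod _ Integrable.of_finite]

lemma integral_comp_perm (e : Equiv.Perm (Fin n)) (g : (Fin n → PrefList p) → ℝ) :
    ∫ s, g (s ∘ e) ∂(Measure.pi fun _ : Fin n => L) =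
      ∫ s, g s ∂(Measure.pi fun _ : Fin n => L) := by
  have h := measurePreserving_piCongrLeft (fun _ : Fin n => L) e.symm
  rw [← h.integral_comp (MeasurableEquiv.measurableEmbedding _) g]
  congr 1 with s
  congr 1
  ext1 j
  have := MeasurableEquiv.piCongrLeft_apply_apply (β := fun _ => PrefList p) (e := e.symm) s (e j)
  simpa using this.symm

lemma firstChoosers_congr {k : Fin p → ℕ} {s s' : Fin n → PrefList p} {l : List (Fin n)}
    (h : ∀ i ∈ l, s i = s' i) (M : Assignment n p) :
    firstChoosers k s l M = firstChoosers k s' l M := by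
  induction l generalizing M with
  | nil => rfl
  | cons i l ih =>
    have hi := h i (by simp)
    have hs : stableStep k s M i = stableStep k s' M i := by simp [stableStep, hi]
    rw [firstChoosers, firstChoosers, hi, hs, ih fun j hj => h j (by simp [hj])]

/-- The probability that the first choice of a random list is available. -/
noncomputable def openProb (k : Fin p → ℕ) (M : Assignment n p) : ℝ :=
  L.real {t | FirstOpen k M t}

open Classical in
/-- Resampling the list of the first candidate of the list. -/
lemma integral_firstChoosers_cons (k : Fin p → ℕ) (φ : Finset (Fin n) → ℝ) {i : Fin n}
    {l : List (Fin n)} (hi : i ∉ l) (M : Assignment n p) :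
    ∫ s, φ (firstChoosers k s (i :: l) M) ∂(Measure.pi fun _ : Fin n => L) =
      ∫ t, ∫ s, φ ((if FirstOpen k M t then {i} else ∅) ∪
        firstChoosers k s l (Function.update M i (firstVacant k t M)))
          ∂(Measure.pi fun _ : Fin n => L) ∂L := by
  rw [integral_update L i]
  congr 1 with t
  congr 1 with s
  rw [firstChoosers, stableStep, Function.update_self]
  congr 2
  refine firstChoosers_congr (fun j hj => ?_) _
  rw [Function.update_of_ne (ne_of_mem_of_not_mem hj hi)]

/-- If `f (A ∪ ·)` increases in the mean under adding random elements, for all pairs `(A, l)` that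
can occur in the process, then the mean of `f` over the random set of those who get their
first choice is at most the one with a constant probability of getting it. -/
lemma integral_firstChoosers_le_thinMean (k : Fin p → ℕ) (f : Finset (Fin n) → ℝ)
    (G : Finset (Fin n) → List (Fin n) → Prop)
    (hG : ∀ A i l, G A (i :: l) → G A l ∧ G (insert i A) l)
    (hf : ∀ A l, G A l → ∀ B ⊆ l.toFinset,
      ∑ j ∈ B, f (A ∪ B.erase j) ≤ B.card * f (A ∪ B))
    (l : List (Fin n)) (hl : l.Nodup) (A : Finset (Fin n)) (hA : G A l) (M : Assignment n p)
    (hM : ∀ i ∈ l, M i = none) :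
    ∫ s, f (A ∪ firstChoosers k s l M) ∂(Measure.pi fun _ : Fin n => L) ≤
      thinMean l.toFinset (fun B => f (A ∪ B)) (openProb L k M) := by
  classical
  induction l generalizing A M with
  | nil => simp [firstChoosers, thinMean_empty]
  | cons i l ih =>
    rw [List.nodup_cons] at hl
    obtain ⟨hA1, hA2⟩ := hG A i l hA
    have hMi : M i = none := hM i (by simp)
    rw [integral_firstChoosers_cons L k (fun B => f (A ∪ B)) hl.1, List.toFinset_cons,
      thinMean_insert (by simpa using hl.1)]
    have hq0 : ∀ M', 0 ≤ openProb L k (M' : Assignment n p) := fun M' => measureReal_nonneg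
    have hq1 : openProb L k M ≤ 1 := measureReal_le_one
    set a := thinMean l.toFinset (fun B => f (A ∪ B)) (openProb L k M) with ha
    set b := thinMean l.toFinset (fun B => f (A ∪ insert i B)) (openProb L k M) with hb
    -- Given the list `t` of candidate `i`, induction bounds the rest by thinning with the new
    -- opening probability. That probability is no larger than the old one, so monotonicity restores
    -- the old one.
    have hstep : ∀ t : PrefList p,
        ∫ s, f (A ∪ ((if FirstOpen k M t then {i} else ∅) ∪
          firstChoosers k s l (Function.update M i (firstVacant k t M))))
            ∂(Measure.pi fun _ : Fin n => L) ≤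
          {t | FirstOpen k M t}.indicator (fun _ => b - a) t + a := by
      intro t
      set M' := Function.update M i (firstVacant k t M) with hM'
      have hMs : M' = stableStep k (fun _ => t) M i := rfl
      have hM'l : ∀ j ∈ l, M' j = none := fun j hj => by
        rw [hMs, stableStep_of_ne _ _ _ (ne_of_mem_of_not_mem hj hl.1)]
        exact hM j (by simp [hj])
      have hqq : openProb L k M' ≤ openProb L k M :=
        measureReal_mono fun u hu => FirstOpen.of_stableStep (s := fun _ => t) hMi (hMs ▸ hu)
      by_cases ho : FirstOpen k M t
      · rw [Set.indicator_of_mem (by exact ho), sub_add_cancel, hb]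
        have h1 := ih hl.2 (insert i A) hA2 M' hM'l
        have h2 := thinMean_mono (P := l.toFinset) (g := fun B => f (insert i A ∪ B))
          (hf _ l hA2) (hq0 M') hqq hq1
        have e : ∀ B, A ∪ insert i B = insert i A ∪ B := fun B => by
          rw [Finset.union_insert, Finset.insert_union]
        simp only [if_pos ho, Finset.singleton_union, e]
        exact h1.trans h2
      · rw [Set.indicator_of_notMem (by exact ho), zero_add]
        have h1 := ih hl.2 A hA1 M' hM'l
        have h2 := thinMean_mono (P := l.toFinset) (g := fun B => f (A ∪ B))
          (hf _ l hA1) (hq0 M') hqq hq1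
        simp only [if_neg ho, Finset.empty_union]
        exact h1.trans h2
    refine (integral_mono Integrable.of_finite Integrable.of_finite hstep).trans_eq ?_
    rw [integral_add Integrable.of_finite Integrable.of_finite,
      integral_indicator (Set.toFinite _).measurableSet]
    simp only [integral_const, smul_eq_mul, probReal_univ, one_mul, measureReal_restrict_apply_univ]
    rw [openProb] at *
    ring

end Lists

/-! ### Capped ratios under removal of elements. -/

section Capped

variable {ι : Type*} [DecidableEq ι]

/-- The ratio of the numbers of members of `F` inside and outside `H`, scaled by `c` and
capped at `1`. -/
noncomputable def cappedRatio (c : ℝ) (F H : Finset ι) : ℝ :=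
  min 1 (c * ((F ∩ H).card / (F \ H).card))

/-- `cappedRatio` for the set `F` with one more element outside `H`. -/
noncomputable def cappedRatioSucc (c : ℝ) (F H : Finset ι) : ℝ :=
  min 1 (c * ((F ∩ H).card / (1 + (F \ H).card)))

lemma cappedRatio_insert (c : ℝ) {F H : Finset ι} {i : ι} (hF : i ∉ F) (hH : i ∉ H) :
    cappedRatio c (insert i F) H = cappedRatioSucc c F H := by
  rw [cappedRatio, cappedRatioSucc, Finset.insert_inter_of_notMem hH,
    Finset.insert_sdiff_of_notMem _ hH, Finset.card_insert_of_notMem (by simp [hF])]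
  push_cast
  rw [add_comm]

lemma cappedRatio_nonneg {c : ℝ} (hc : 0 ≤ c) (F H : Finset ι) : 0 ≤ cappedRatio c F H :=
  le_min zero_le_one (by positivity)

lemma cappedRatio_le_one (c : ℝ) (F H : Finset ι) : cappedRatio c F H ≤ 1 := min_le_left _ _

lemma cappedRatio_map (c : ℝ) (F H : Finset ι) (e : Equiv.Perm ι) :
    cappedRatio c (F.map e.toEmbedding) (H.map e.toEmbedding) = cappedRatio c F H := by
  rw [cappedRatio, ← Finset.map_inter, ← Finset.map_sdiff, Finset.card_map, Finset.card_map,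
    cappedRatio]

lemma cappedRatioSucc_map (c : ℝ) (F H : Finset ι) (e : Equiv.Perm ι) :
    cappedRatioSucc c (F.map e.toEmbedding) (H.map e.toEmbedding) = cappedRatioSucc c F H := by
  rw [cappedRatioSucc, ← Finset.map_inter, ← Finset.map_sdiff, Finset.card_map, Finset.card_map,
    cappedRatioSucc]

/-- Removing a random element of a set `B` that contains all of `U ∩ H` does not increase the
capped ratio in the mean. -/
lemma sum_cappedRatioSucc_erase_le {c : ℝ} (hc : 0 ≤ c) {U B H : Finset ι} (hB : B ⊆ U)
    (hUH : U ∩ H ⊆ B) :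
    ∑ j ∈ B, cappedRatioSucc c (U.erase j) H ≤ B.card * cappedRatioSucc c U H := by
  have hBH : B ∩ H = U ∩ H := by
    ext a
    simp only [Finset.mem_inter]
    exact ⟨fun h => ⟨hB h.1, h.2⟩, fun h => ⟨hUH (Finset.mem_inter.2 h), h.2⟩⟩
  have hcard : (B.card : ℝ) = (U ∩ H).card + (B \ H).card := by
    rw [← hBH]; exact_mod_cast (Finset.card_inter_add_card_sdiff B H).symm
  set N : ℝ := ((U \ H).card : ℝ) with hN
  set m : ℝ := ((U ∩ H).card : ℝ) with hm
  have hle : ((B \ H).card : ℝ) ≤ N := by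
    exact Nat.cast_le.2 (Finset.card_le_card (Finset.sdiff_subset_sdiff hB subset_rfl))
  -- With `b = |B \ H|` the left side is `m(m-1)/(1+N) + bm/N`, and the slack is `m(N-b)/(N(1+N))`.
  -- The extra `1` in the denominator is essential for this balance.
  have hsum : ∑ j ∈ B, (((U.erase j) ∩ H).card : ℝ) / (1 + ((U.erase j) \ H).card) ≤
      B.card * (m / (1 + N)) := by
    rw [← Finset.sum_inter_add_sum_sdiff B H]
    have h1 : ∀ j ∈ B ∩ H, (((U.erase j) ∩ H).card : ℝ) / (1 + ((U.erase j) \ H).card) =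
        (m - 1) / (1 + N) := by
      intro j hj
      rw [hBH] at hj
      have e1 : U.erase j ∩ H = (U ∩ H).erase j := Finset.erase_inter _ _ _
      have e2 : U.erase j \ H = U \ H := by
        ext a
        simp only [Finset.mem_sdiff, Finset.mem_erase]
        constructor
        · tauto
        · exact fun h => ⟨⟨fun h' => h.2 (h' ▸ (Finset.mem_inter.1 hj).2), h.1⟩, h.2⟩
      rw [e1, e2, Finset.card_erase_of_mem hj, Nat.cast_sub (Finset.card_pos.2 ⟨j, hj⟩)]
      simp [hm, hN]
    have h2 : ∀ j ∈ B \ H, (((U.erase j) ∩ H).card : ℝ) / (1 + ((U.erase j) \ H).card) =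
        m / N := by
      intro j hj
      rw [Finset.mem_sdiff] at hj
      have e1 : U.erase j ∩ H = U ∩ H := by
        ext a
        simp only [Finset.mem_inter, Finset.mem_erase]
        constructor
        · tauto
        · exact fun h => ⟨⟨fun h' => hj.2 (h' ▸ h.2), h.1⟩, h.2⟩
      have e2 : U.erase j \ H = (U \ H).erase j := by
        ext a; simp only [Finset.mem_sdiff, Finset.mem_erase]; tauto
      have hj' : j ∈ U \ H := Finset.mem_sdiff.2 ⟨hB hj.1, hj.2⟩
      rw [e1, e2, Finset.card_erase_of_mem hj', Nat.cast_sub (Finset.card_pos.2 ⟨j, hj'⟩)]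
      simp [hm, hN]
    rw [Finset.sum_congr rfl h1, Finset.sum_congr rfl h2, Finset.sum_const, Finset.sum_const,
      hBH, nsmul_eq_mul, nsmul_eq_mul, hcard, ← hm]
    set b : ℝ := ((B \ H).card : ℝ) with hb
    have hb0 : 0 ≤ b := Nat.cast_nonneg _
    have hm0 : 0 ≤ m := Nat.cast_nonneg _
    rcases (Nat.cast_nonneg _ : (0 : ℝ) ≤ ((U \ H).card : ℝ)).eq_or_lt with h0 | h0
    · have hN0 : N = 0 := h0.symm
      have : b = 0 := le_antisymm (hN0 ▸ hle) hb0
      rw [hN0, this]; simp; nlinarith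
    · have hN0 : 0 < N := h0
      have : (m + b) * (m / (1 + N)) - (m * ((m - 1) / (1 + N)) + b * (m / N)) =
          m * (N - b) / (N * (1 + N)) := by field_simp; ring
      have h3 : 0 ≤ m * (N - b) / (N * (1 + N)) :=
        div_nonneg (mul_nonneg hm0 (by linarith)) (by positivity)
      linarith
  unfold cappedRatioSucc
  rw [mul_min_of_nonneg _ _ (Nat.cast_nonneg _), mul_one]
  refine le_min ?_ ?_
  · calc _ ≤ ∑ j ∈ B, (1 : ℝ) := Finset.sum_le_sum fun j _ => min_le_left _ _
      _ = B.card := by simp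
  · calc _ ≤ ∑ j ∈ B, c * ((((U.erase j) ∩ H).card : ℝ) / (1 + ((U.erase j) \ H).card)) :=
          Finset.sum_le_sum fun j _ => min_le_right _ _
      _ ≤ _ := by
          rw [← Finset.mul_sum, mul_left_comm]
          exact mul_le_mul_of_nonneg_left hsum hc

/-- The sum of the capped ratios over all subsets `H` of `D` of a given size. -/
noncomputable def sumCapped (c : ℝ) (m : ℕ) (D A : Finset ι) : ℝ :=
  ∑ H ∈ D.powersetCard m, cappedRatioSucc c A H

lemma sumCapped_map (c : ℝ) (m : ℕ) {D : Finset ι} (A : Finset ι) (e : Equiv.Perm ι)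
    (he : D.map e.toEmbedding = D) : sumCapped c m D (A.map e.toEmbedding) = sumCapped c m D A := by
  symm
  refine Finset.sum_equiv e.finsetCongr (fun H => ?_) fun H _ => ?_
  · rw [Finset.mem_powersetCard, Finset.mem_powersetCard, Equiv.finsetCongr_apply, Finset.card_map]
    conv_rhs => rw [← he]
    rw [Finset.map_subset_map]
  · rw [Equiv.finsetCongr_apply, cappedRatioSucc_map]

/-- The transposition of `i` and `j` preserves both `U` and `D` and exchanges the two erasures. -/
lemma sumCapped_erase_eq (c : ℝ) (m : ℕ) {D U : Finset ι} {i j : ι} (hi : i ∈ U ∩ D)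
    (hj : j ∈ U ∩ D) : sumCapped c m D (U.erase i) = sumCapped c m D (U.erase j) := by
  have hmap : ∀ V : Finset ι, i ∈ V → j ∈ V → V.map (Equiv.swap i j).toEmbedding = V := by
    intro V hiV hjV
    ext a
    rw [Finset.mem_map_equiv, Equiv.symm_swap]
    rcases eq_or_ne a i with rfl | hai
    · simp [hiV, hjV]
    · rcases eq_or_ne a j with rfl | haj
      · simp [hiV, hjV]
      · rw [Equiv.swap_apply_of_ne_of_ne hai haj]
  rw [Finset.mem_inter] at hi hj
  rw [← sumCapped_map c m (U.erase i) (Equiv.swap i j) (hmap D hi.2 hj.2), Finset.map_erase,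
    hmap U hi.1 hj.1]
  simp

/-- Averaged over `j ∈ U ∩ D` this is the removal inequality, and by symmetry all terms of the
average coincide. -/
lemma sumCapped_erase_le {c : ℝ} (hc : 0 ≤ c) (m : ℕ) {D U : Finset ι} {j : ι}
    (hj : j ∈ U ∩ D) : sumCapped c m D (U.erase j) ≤ sumCapped c m D U := by
  have h1 : ∑ i ∈ U ∩ D, sumCapped c m D (U.erase i) ≤ (U ∩ D).card * sumCapped c m D U := by
    unfold sumCapped
    rw [Finset.sum_comm, Finset.mul_sum]
    refine Finset.sum_le_sum fun H hH => sum_cappedRatioSucc_erase_le hc Finset.inter_subset_left ?_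
    exact Finset.inter_subset_inter subset_rfl (Finset.mem_powersetCard.1 hH).1
  rw [Finset.sum_congr rfl fun i hi => sumCapped_erase_eq c m hi hj, Finset.sum_const,
    nsmul_eq_mul] at h1
  exact le_of_mul_le_mul_left h1 (by exact_mod_cast Finset.card_pos.2 ⟨j, hj⟩)

end Capped

/-! ### First choosers against the selected, averaged over the group. -/

section FixedUtilities

variable {n p : ℕ} (L : Measure (PrefList p)) [IsProbabilityMeasure L]

/-- For fixed estimated utilities `x` and a uniformly random group `H` of size `m` among the
candidates with utility at most `β`, the capped ratio of those who get their first choice is in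
the mean at most the capped ratio of those who are selected. -/
lemma sum_integral_cappedRatio_le {k : Fin p → ℕ} (hk : ∀ a, 0 < k a) (hK : ∑ a, k a ≤ n)
    (hK0 : 0 < ∑ a, k a) {c : ℝ} (hc : 0 ≤ c) (m : ℕ) (x : Fin n → ℝ) (β : ℝ)
    (hβ : ∃ i, β < x i) :
    ∑ H ∈ (Finset.univ.filter fun i => x i ≤ β).powersetCard m,
        ∫ s, cappedRatio c (firstChoosers k s (byDecreasing x) fun _ => none) H
          ∂(Measure.pi fun _ : Fin n => L) ≤
      ∑ H ∈ (Finset.univ.filter fun i => x i ≤ β).powersetCard m,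
        cappedRatio c (topSet (∑ a, k a) x) H := by
  classical
  set D := Finset.univ.filter fun i => x i ≤ β with hD
  have hmemD : ∀ i, i ∈ D ↔ x i ≤ β := fun i => by simp [hD]
  have hnd : ((byDecreasing x).take (∑ a, k a)).Nodup :=
    (byDecreasing_nodup x).sublist (List.take_sublist _ _)
  have hpw : ((byDecreasing x).take (∑ a, k a)).Pairwise fun i j => x j ≤ x i :=
    (byDecreasing_pairwise x).sublist (List.take_sublist _ _)
  have hlen : ((byDecreasing x).take (∑ a, k a)).length = ∑ a, k a := by
    rw [List.length_take, byDecreasing_length, min_eq_left hK]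
  have htop := isTop_topSet hK x
  simp only [firstChoosers_byDecreasing k hK, topSet] at htop ⊢
  generalize hl : (byDecreasing x).take (∑ a, k a) = l at *
  cases l with
  | nil => simp at hlen; omega
  | cons t l =>
    rw [List.nodup_cons] at hnd
    rw [List.pairwise_cons] at hpw
    -- The top candidate is in no possible group `H`, and it always gets its first choice; this
    -- supplies the `1` in the denominators.
    have htD : t ∉ D := by
      rw [hmemD, not_le]
      obtain ⟨i, hi⟩ := hβ
      by_cases h : i ∈ (t :: l).toFinset
      · rw [List.mem_toFinset, List.mem_cons] at h
        rcases h with rfl | h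
        · exact hi
        · exact hi.trans_le (hpw.1 i h)
      · exact hi.trans_le (htop.2 t (by simp) i h)
    have htH : ∀ H ∈ D.powersetCard m, t ∉ H := fun H hH h =>
      htD ((Finset.mem_powersetCard.1 hH).1 h)
    have htl : t ∉ l.toFinset := by simpa using hnd.1
    have hR : ∑ H ∈ D.powersetCard m, cappedRatio c (t :: l).toFinset H =
        sumCapped c m D l.toFinset := by
      refine Finset.sum_congr rfl fun H hH => ?_
      rw [List.toFinset_cons, cappedRatio_insert c htl (htH H hH)]
    rw [hR, ← integral_finsetSum _ fun _ _ => integrable_lists L _,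
      integral_firstChoosers_cons L k
        (fun F => ∑ H ∈ D.powersetCard m, cappedRatio c F H) hnd.1]
    have hopen : ∀ u : PrefList p, FirstOpen k (fun _ : Fin n => (none : Option (Fin p))) u := by
      intro u
      have hp : 0 < p := by
        rcases p.eq_zero_or_pos with h | h
        · subst h; simp at hK0
        · exact h
      exact ⟨⟨0, hp⟩, rfl, by simpa [assignedTo] using hk _⟩
    have hbound : ∀ u : PrefList p,
        ∫ s, ∑ H ∈ D.powersetCard m, cappedRatio c
          ((if FirstOpen k (fun _ : Fin n => (none : Option (Fin p))) u then {t} else ∅) ∪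
          firstChoosers k s l (Function.update (fun _ : Fin n => (none : Option (Fin p))) t
            (firstVacant k u fun _ : Fin n => none))) H ∂(Measure.pi fun _ : Fin n => L) ≤
        sumCapped c m D l.toFinset := by
      intro u
      set M := Function.update (fun _ : Fin n => (none : Option (Fin p))) t
            (firstVacant k u fun _ : Fin n => none) with hM
      have e1 : ∀ s : Fin n → PrefList p, ∑ H ∈ D.powersetCard m, cappedRatio c
          ((if FirstOpen k (fun _ : Fin n => (none : Option (Fin p))) u then {t} else ∅) ∪
          firstChoosers k s l M) H = sumCapped c m D (∅ ∪ firstChoosers k s l M) := by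
        intro s
        refine Finset.sum_congr rfl fun H hH => ?_
        rw [if_pos (hopen u), ← Finset.insert_eq, Finset.empty_union, cappedRatio_insert c
          (fun h => htl (firstChoosers_subset k s l M h)) (htH H hH)]
      simp_rw [e1]
      -- The invariant uses that candidates above `β` come before those of `D`. Either the set `A`
      -- of earlier first choosers avoids `D`, or only candidates of `D` remain.
      refine (integral_firstChoosers_le_thinMean L k (sumCapped c m D)
        (fun A l => l.Nodup ∧ (∀ i ∈ l, i ∉ A) ∧ (l.Pairwise fun i j => i ∈ D → j ∈ D) ∧
          ((∀ i ∈ D, i ∉ A) ∨ ∀ i ∈ l, i ∈ D)) ?_ ?_ l hnd.2 ∅ ?_ M ?_).trans ?_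
      · rintro A i l ⟨h1, h2, h3, h4⟩
        rw [List.nodup_cons] at h1
        rw [List.pairwise_cons] at h3
        refine ⟨⟨h1.2, fun j hj => h2 j (by simp [hj]), h3.2,
          h4.imp_right fun h j hj => h j (by simp [hj])⟩, h1.2, fun j hj => ?_, h3.2, ?_⟩
        · rw [Finset.mem_insert, not_or]
          exact ⟨ne_of_mem_of_not_mem hj h1.1, h2 j (by simp [hj])⟩
        · by_cases hi : i ∈ D
          · exact Or.inr fun j hj => h3.1 j hj hi
          · rcases h4 with h4 | h4
            · refine Or.inl fun j hj => ?_
              rw [Finset.mem_insert, not_or]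
              exact ⟨ne_of_mem_of_not_mem hj hi, h4 j hj⟩
            · exact absurd (h4 i (by simp)) hi
      · rintro A l ⟨h1, h2, h3, h4⟩ B hB
        have herase : ∀ j ∈ B, A ∪ B.erase j = (A ∪ B).erase j := fun j hj => by
          rw [Finset.erase_union_distrib, Finset.erase_eq_of_notMem
            (h2 j (List.mem_toFinset.1 (hB hj)))]
        rw [Finset.sum_congr rfl fun j hj => by rw [herase j hj]]
        -- If `A` avoids `D`, then `B` contains `(A ∪ B) ∩ H` and the removal inequality holds for
        -- each `H`. Otherwise `B ⊆ D`, and each single erasure lowers the sum over `H`.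
        rcases h4 with h4 | h4
        · unfold sumCapped
          rw [Finset.sum_comm, Finset.mul_sum]
          refine Finset.sum_le_sum fun H hH =>
            sum_cappedRatioSucc_erase_le hc Finset.subset_union_right fun a ha => ?_
          rw [Finset.mem_inter, Finset.mem_union] at ha
          exact ha.1.resolve_left (h4 a ((Finset.mem_powersetCard.1 hH).1 ha.2))
        · calc _ ≤ ∑ j ∈ B, sumCapped c m D (A ∪ B) := by
                refine Finset.sum_le_sum fun j hj => sumCapped_erase_le hc m ?_
                exact Finset.mem_inter.2 ⟨Finset.mem_union_right _ hj,
                  h4 j (List.mem_toFinset.1 (hB hj))⟩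
            _ = _ := by rw [Finset.sum_const, nsmul_eq_mul]
      · refine ⟨hnd.2, by simp, hpw.2.imp fun h hi => ?_, Or.inl (by simp)⟩
        rw [hmemD] at hi ⊢
        exact h.trans hi
      · intro i hi
        rw [hM, Function.update_of_ne (ne_of_mem_of_not_mem hi hnd.1)]
      -- Retention probability `1` keeps the whole top set.
      · refine (thinMean_mono (q := 1) ?_ measureReal_nonneg measureReal_le_one le_rfl).trans ?_
        · intro B hB
          unfold sumCapped
          rw [Finset.sum_comm, Finset.mul_sum]
          refine Finset.sum_le_sum fun H hH => ?_
          simp only [Finset.empty_union]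
          exact sum_cappedRatioSucc_erase_le hc subset_rfl Finset.inter_subset_left
        · rw [thinMean_one, Finset.empty_union]
    refine (integral_mono Integrable.of_finite Integrable.of_finite hbound).trans_eq ?_
    simp

end FixedUtilities

/-! ### Measurability of functions of the ranking. -/

section Measurability

variable {n p : ℕ}

open Classical in
/-- The sorted list of candidates as a function of the outcomes of the comparisons. -/
noncomputable def sortBy (n : ℕ) (r : Fin n → Fin n → Prop) : List (Fin n) :=
  (List.finRange n).insertionSort r

lemma byDecreasing_eq_sortBy (x : Fin n → ℝ) :
    byDecreasing x = sortBy n fun i j => x j ≤ x i := by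
  unfold byDecreasing sortBy
  congr!

lemma measurable_comparisons :
    Measurable fun x : Fin n → ℝ => (fun i j : Fin n => x j ≤ x i) := by
  refine measurable_pi_iff.2 fun i => measurable_pi_iff.2 fun j => ?_
  exact measurableSet_setOfPred.1 (measurableSet_le (measurable_pi_apply j) (measurable_pi_apply i))

/-- The ranking factors through the finitely many outcomes of the pairwise comparisons, so `φ` may
be arbitrary. -/
lemma measurable_comp_byDecreasing {γ : Type*} [MeasurableSpace γ] (φ : List (Fin n) → γ) :
    Measurable fun x : Fin n → ℝ => φ (byDecreasing x) := by
  simp_rw [byDecreasing_eq_sortBy]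
  exact (measurable_of_finite (fun r : Fin n → Fin n → Prop => φ (sortBy n r))).comp
    measurable_comparisons

lemma measurable_comp_byDecreasing_prod {γ : Type*} [MeasurableSpace γ]
    (φ : List (Fin n) → (Fin n → PrefList p) → γ) :
    Measurable fun w : (Fin n → ℝ) × (Fin n → PrefList p) => φ (byDecreasing w.1) w.2 := by
  simp_rw [byDecreasing_eq_sortBy]
  exact (measurable_of_finite (fun r : (Fin n → Fin n → Prop) × (Fin n → PrefList p) =>
    φ (sortBy n r.1) r.2)).comp ((measurable_comparisons.comp measurable_fst).prodMk measurable_snd)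

lemma measurable_estimated (G₁ : Finset (Fin n)) (β : ℝ) : Measurable (estimated G₁ β) := by
  refine measurable_pi_iff.2 fun i => ?_
  by_cases h : i ∈ G₁ <;> simp only [estimated, h, if_true, if_false] <;> fun_prop

end Measurability

/-! ### The uniform law: genericity and exchangeability. -/

section UniformLaw

instance : IsProbabilityMeasure uniform01 := ⟨by simp [uniform01]⟩

/-- The law of `n` independent uniform utilities. -/
noncomputable def unifLaw (n : ℕ) : Measure (Fin n → ℝ) := Measure.pi fun _ => uniform01

instance (n : ℕ) : IsProbabilityMeasure (unifLaw n) := by unfold unifLaw; infer_instance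

variable {n : ℕ}

/-- The vectors in the unit cube whose coordinates in `H` are at most `β`. -/
def cubeBox (β : ℝ) (H : Finset (Fin n)) : Set (Fin n → ℝ) :=
  Set.univ.pi fun i => Set.Icc 0 (if i ∈ H then β else 1)

lemma measurableSet_cubeBox (β : ℝ) (H : Finset (Fin n)) : MeasurableSet (cubeBox β H) :=
  MeasurableSet.univ_pi fun _ => measurableSet_Icc

lemma unifLaw_eq (n : ℕ) :
    unifLaw n = volume.restrict (Set.univ.pi fun _ : Fin n => Set.Icc 0 1) := by
  rw [unifLaw, volume_pi, Measure.restrict_pi_pi]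
  rfl

lemma ae_mem_Icc : ∀ᵐ u ∂(unifLaw n), ∀ i, u i ∈ Set.Icc (0 : ℝ) 1 := by
  rw [unifLaw_eq]
  filter_upwards [ae_restrict_mem (MeasurableSet.univ_pi fun _ => measurableSet_Icc)] with u hu i
  exact hu i trivial

/-- The kernel is a proper subspace, hence null. This excludes ties and zero utilities. -/
lemma ae_volume_ne_zero (f : (Fin n → ℝ) →ₗ[ℝ] ℝ) {v : Fin n → ℝ} (hv : f v ≠ 0) :
    ∀ᵐ u : Fin n → ℝ, f u ≠ 0 := by
  rw [ae_iff]
  simp only [ne_eq, not_not]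
  refine Measure.addHaar_submodule volume (LinearMap.ker f) fun h => hv ?_
  have : v ∈ LinearMap.ker f := h ▸ Submodule.mem_top
  simpa using this

lemma ae_volume_injective : ∀ᵐ x : Fin n → ℝ, Function.Injective x := by
  have : ∀ i j : Fin n, ∀ᵐ x : Fin n → ℝ, i ≠ j → x i ≠ x j := by
    intro i j
    by_cases h : i = j
    · simp [h]
    · filter_upwards [ae_volume_ne_zero ((LinearMap.proj i : (Fin n → ℝ) →ₗ[ℝ] ℝ) -
          (LinearMap.proj j : (Fin n → ℝ) →ₗ[ℝ] ℝ))
        (v := Pi.single i 1) (by simp [Ne.symm h])] with x hx _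
      simpa [sub_ne_zero] using hx
  filter_upwards [ae_all_iff.2 fun i => ae_all_iff.2 (this i)] with x hx i j hij
  by_contra h
  exact hx i j h hij

lemma ae_estimated_injective (G₁ : Finset (Fin n)) {β : ℝ} (hβ : 0 < β) :
    ∀ᵐ u ∂(unifLaw n), Function.Injective (estimated G₁ β u) := by
  rw [unifLaw_eq]
  refine ae_restrict_of_ae ?_
  have : ∀ i j : Fin n, ∀ᵐ x : Fin n → ℝ, i ≠ j → estimated G₁ β x i ≠ estimated G₁ β x j := by
    intro i j
    by_cases h : i = j
    · simp [h]
    · let a : Fin n → ℝ := fun i => if i ∈ G₁ then 1 else β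
      have ha : ∀ i, a i ≠ 0 := fun i => by
        simp only [a]; split_ifs <;> simp [hβ.ne']
      have hest : ∀ (x : Fin n → ℝ) i, estimated G₁ β x i = a i * x i := fun x i => by
        simp only [estimated, a]; split_ifs <;> simp
      filter_upwards [ae_volume_ne_zero (a i • (LinearMap.proj i : (Fin n → ℝ) →ₗ[ℝ] ℝ) -
          a j • (LinearMap.proj j : (Fin n → ℝ) →ₗ[ℝ] ℝ))
        (v := Pi.single i 1) (by simp [Ne.symm h, ha])] with x hx _
      rw [hest, hest]
      simpa [sub_ne_zero] using hx
  filter_upwards [ae_all_iff.2 fun i => ae_all_iff.2 (this i)] with x hx i j hij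
  by_contra h
  exact hx i j h hij

lemma ae_pos : ∀ᵐ u ∂(unifLaw n), ∀ i, 0 < u i := by
  have : ∀ i : Fin n, ∀ᵐ u ∂(unifLaw n), u i ≠ 0 := fun i => by
    rw [unifLaw_eq]
    refine ae_restrict_of_ae ?_
    exact ae_volume_ne_zero (LinearMap.proj i) (v := Pi.single i 1) (by simp)
  filter_upwards [ae_all_iff.2 this, ae_mem_Icc] with u h1 h2 i
  exact (h2 i).1.lt_of_ne (h1 i).symm

/-- Change of variables from latent to estimated utilities. -/
lemma exists_integral_estimated (G₁ : Finset (Fin n)) {β : ℝ} (hβ : 0 < β) :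
    ∃ c : ℝ, 0 ≤ c ∧ ∀ g : (Fin n → ℝ) → ℝ, Measurable g →
      ∫ u, g (estimated G₁ β u) ∂(unifLaw n) = c * ∫ x in cubeBox β G₁ᶜ, g x := by
  classical
  let a : Fin n → ℝ := fun i => if i ∈ G₁ then 1 else β
  have ha : ∀ i, 0 < a i := fun i => by simp only [a]; split_ifs <;> simp [hβ]
  have hest : ∀ x : Fin n → ℝ, estimated G₁ β x = Matrix.toLin' (Matrix.diagonal a) x := by
    intro x
    ext i
    simp only [estimated, a, Matrix.toLin'_apply, Matrix.mulVec_diagonal]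
    split_ifs <;> simp
  have hdet : (Matrix.diagonal a).det ≠ 0 := by
    rw [Matrix.det_diagonal]
    exact Finset.prod_ne_zero_iff.2 fun i _ => (ha i).ne'
  have hmap := Real.smul_map_diagonal_volume_pi hdet
  have hpre : estimated G₁ β ⁻¹' cubeBox β G₁ᶜ = Set.univ.pi fun _ => Set.Icc 0 1 := by
    ext u
    simp only [cubeBox, Set.mem_preimage, Set.mem_pi, Set.mem_univ, true_implies, Set.mem_Icc,
      Finset.mem_compl, estimated]
    refine forall_congr' fun i => ?_
    by_cases h : i ∈ G₁
    · simp [h]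
    · simp only [h, not_false_eq_true, if_true, if_false]
      rw [mul_nonneg_iff_of_pos_left hβ, mul_le_iff_le_one_right hβ]
  -- The estimate is a diagonal linear map taking the unit cube onto the box, so its Jacobian is
  -- constant.
  refine ⟨|(Matrix.diagonal a).det|⁻¹, by positivity, fun g hg => ?_⟩
  have hT : (fun x => estimated G₁ β x) = fun x => Matrix.toLin' (Matrix.diagonal a) x :=
    funext hest
  have h1 : ∫ x in cubeBox β G₁ᶜ, g x =
      |(Matrix.diagonal a).det| * ∫ u, g (estimated G₁ β u) ∂(unifLaw n) := by
    conv_lhs => rw [← hmap]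
    rw [Measure.restrict_smul, integral_smul_measure, smul_eq_mul,
      ENNReal.toReal_ofReal (abs_nonneg _)]
    congr 1
    rw [show (⇑(Matrix.toLin' (Matrix.diagonal a)) : (Fin n → ℝ) → Fin n → ℝ) = estimated G₁ β
      from hT.symm, setIntegral_map (measurableSet_cubeBox _ _) hg.aestronglyMeasurable
      (measurable_estimated G₁ β).aemeasurable, unifLaw_eq, hpre]
  rw [h1, inv_mul_cancel_left₀ (abs_ne_zero.2 hdet)]

lemma measurePreserving_comp_perm (e : Equiv.Perm (Fin n)) :
    MeasurePreserving (fun x : Fin n → ℝ => x ∘ e) volume volume := by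
  have h := volume_measurePreserving_piCongrLeft (fun _ : Fin n => ℝ) e.symm
  convert h using 1
  ext x j
  have := MeasurableEquiv.piCongrLeft_apply_apply (β := fun _ => ℝ) (e := e.symm) x (e j)
  simpa using this.symm

/-- Permuting coordinates preserves volume and carries one box to the other, so the integral depends
on the group only through its size. -/
lemma setIntegral_cubeBox_map {g : (Fin n → ℝ) → Finset (Fin n) → ℝ} (β : ℝ)
    (e : Equiv.Perm (Fin n))
    (hequiv : ∀ x, Function.Injective x → ∀ H, g (x ∘ e) H = g x (H.map e.toEmbedding))
    (hg : ∀ H, Measurable fun x => g x H) (H : Finset (Fin n)) :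
    ∫ x in cubeBox β (H.map e.toEmbedding), g x (H.map e.toEmbedding) =
      ∫ x in cubeBox β H, g x H := by
  have hmp := measurePreserving_comp_perm e
  have hpre : (fun x : Fin n → ℝ => x ∘ e) ⁻¹' cubeBox β H = cubeBox β (H.map e.toEmbedding) := by
    ext x
    simp only [cubeBox, Set.mem_preimage, Set.mem_pi, Set.mem_univ, true_implies]
    rw [← e.forall_congr_right (q := fun j =>
      x j ∈ Set.Icc 0 (if j ∈ H.map e.toEmbedding then β else 1))]
    refine forall_congr' fun i => ?_
    simp
  conv_rhs => rw [← hmp.map_eq]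
  rw [setIntegral_map (measurableSet_cubeBox _ _) (hg H).aestronglyMeasurable
    hmp.measurable.aemeasurable, hpre]
  refine integral_congr_ae (ae_restrict_of_ae ?_)
  filter_upwards [ae_volume_injective] with x hx
  exact (hequiv x hx H).symm

lemma exists_perm_map {H H' : Finset (Fin n)} (h : H.card = H'.card) :
    ∃ e : Equiv.Perm (Fin n), H.map e.toEmbedding = H' := by
  classical
  let e₀ : {i // i ∈ H} ≃ {i // i ∈ H'} := Finset.equivOfCardEq h
  refine ⟨e₀.extendSubtype, Finset.eq_of_subset_of_card_le (fun j hj => ?_) (by simp [h])⟩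
  obtain ⟨i, hi, rfl⟩ := Finset.mem_map.1 hj
  exact e₀.extendSubtype_mem i hi

/-- Exchangeability of the candidates with estimated utility at most `β`: an equivariant function
has a nonnegative mean if its sums over all possible disadvantaged groups are nonnegative. -/
lemma integral_estimated_nonneg {g : (Fin n → ℝ) → Finset (Fin n) → ℝ} {β : ℝ} (hβ : 0 < β)
    (hβ1 : β ≤ 1)
    (hequiv : ∀ (e : Equiv.Perm (Fin n)) (x : Fin n → ℝ), Function.Injective x →
      ∀ H, g (x ∘ e) H = g x (H.map e.toEmbedding))
    (hg : ∀ H, Measurable fun x => g x H) {C : ℝ} (hC : ∀ x H, |g x H| ≤ C) (m : ℕ)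
    (hpos : ∀ x, 0 ≤ ∑ H ∈ (Finset.univ.filter fun i => x i ≤ β).powersetCard m, g x H)
    (G₁ : Finset (Fin n)) (hm : G₁ᶜ.card = m) :
    Integrable (fun u => g (estimated G₁ β u) G₁ᶜ) (unifLaw n) ∧
      0 ≤ ∫ u, g (estimated G₁ β u) G₁ᶜ ∂(unifLaw n) := by
  classical
  refine ⟨Integrable.of_bound ((hg _).comp (measurable_estimated G₁ β)).aestronglyMeasurable C
    (Filter.Eventually.of_forall fun u => hC _ _), ?_⟩
  obtain ⟨c, hc, hint⟩ := exists_integral_estimated G₁ hβ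
  rw [hint (fun x => g x G₁ᶜ) (hg _)]
  refine mul_nonneg hc ?_
  set P := (Finset.univ : Finset (Fin n)).powersetCard m with hP
  have hbox : ∀ H : Finset (Fin n), cubeBox β H =
      (Set.univ.pi fun _ => Set.Icc 0 1) ∩ {x | ∀ i ∈ H, x i ≤ β} := by
    intro H
    ext x
    simp only [cubeBox, Set.mem_pi, Set.mem_univ, true_implies, Set.mem_Icc, Set.mem_inter_iff,
      Set.mem_ofPred_eq]
    constructor
    · intro h
      refine ⟨fun i => ⟨(h i).1, (h i).2.trans ?_⟩, fun i hi => by simpa [hi] using (h i).2⟩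
      split_ifs <;> simp [hβ1]
    · rintro ⟨h1, h2⟩ i
      refine ⟨(h1 i).1, ?_⟩
      split_ifs with hi
      exacts [h2 i hi, (h1 i).2]
  have hmeasH : ∀ H : Finset (Fin n), MeasurableSet {x : Fin n → ℝ | ∀ i ∈ H, x i ≤ β} := by
    intro H
    have : {x : Fin n → ℝ | ∀ i ∈ H, x i ≤ β} = ⋂ i ∈ H, {x | x i ≤ β} := by ext; simp
    rw [this]
    exact H.measurableSet_biInter fun i _ =>
      measurableSet_le (measurable_pi_apply i) measurable_const
  have hall : ∀ H ∈ P, ∫ x in cubeBox β H, g x H = ∫ x in cubeBox β G₁ᶜ, g x G₁ᶜ := by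
    intro H hH
    obtain ⟨e, he⟩ := exists_perm_map (H := G₁ᶜ) (H' := H)
      (by rw [hm, (Finset.mem_powersetCard.1 hH).2])
    rw [← he]
    exact setIntegral_cubeBox_map β e (hequiv e) hg _
  -- All these box integrals agree. After exchanging sum and integral, a point `x` of the cube
  -- contributes exactly the groups `H` contained in `{x ≤ β}`.
  have hsum : ∑ H ∈ P, ∫ x in cubeBox β H, g x H =
      ∫ x, ∑ H ∈ P, {x : Fin n → ℝ | ∀ i ∈ H, x i ≤ β}.indicator (fun x => g x H) x
        ∂(unifLaw n) := by
    rw [integral_finsetSum]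
    · refine Finset.sum_congr rfl fun H _ => ?_
      rw [integral_indicator (hmeasH H), unifLaw_eq, Measure.restrict_restrict (hmeasH H), hbox,
        Set.inter_comm]
    · intro H _
      exact (Integrable.of_bound (hg H).aestronglyMeasurable C
        (Filter.Eventually.of_forall fun x => hC x H)).indicator (hmeasH H)
  rw [Finset.sum_congr rfl hall, Finset.sum_const, nsmul_eq_mul] at hsum
  have hnn : 0 ≤ ∫ x, ∑ H ∈ P, {x : Fin n → ℝ | ∀ i ∈ H, x i ≤ β}.indicator (fun x => g x H) x
        ∂(unifLaw n) := by
    refine integral_nonneg fun x => ?_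
    have : ∑ H ∈ P, {x : Fin n → ℝ | ∀ i ∈ H, x i ≤ β}.indicator (fun x => g x H) x =
        ∑ H ∈ (Finset.univ.filter fun i => x i ≤ β).powersetCard m, g x H := by
      simp only [Set.indicator_apply, Set.mem_ofPred_eq]
      rw [← Finset.sum_filter]
      refine Finset.sum_congr ?_ fun _ _ => rfl
      ext H
      simp only [hP, Finset.mem_filter, Finset.mem_powersetCard, Finset.subset_iff,
        Finset.mem_univ, true_and]
      tauto
    simp only [Pi.zero_apply, this]
    exact hpos x
  rw [← hsum] at hnn
  have hPpos : (0 : ℝ) < P.card := by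
    exact_mod_cast Finset.card_pos.2 ⟨G₁ᶜ, Finset.mem_powersetCard.2 ⟨Finset.subset_univ _, hm⟩⟩
  exact nonneg_of_mul_nonneg_right hnn hPpos

end UniformLaw

/-! ### The mean comparison at random utilities. -/

section Comparison

variable {n p : ℕ} (L : Measure (PrefList p)) [IsProbabilityMeasure L]

lemma topSet_comp_perm (K : ℕ) {x : Fin n → ℝ} (hx : Function.Injective x)
    (e : Equiv.Perm (Fin n)) : topSet K (x ∘ e) = (topSet K x).map e.symm.toEmbedding := by
  ext i
  simp [topSet, byDecreasing_comp_perm x hx, ← List.map_take, Finset.mem_map_equiv, List.mem_map,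
    Equiv.symm_apply_eq]

lemma cappedRatio_map_symm (c : ℝ) (F H : Finset (Fin n)) (e : Equiv.Perm (Fin n)) :
    cappedRatio c (F.map e.symm.toEmbedding) H = cappedRatio c F (H.map e.toEmbedding) := by
  rw [← cappedRatio_map c _ H e]
  congr 1
  ext i
  simp [Finset.mem_map_equiv]

/-- The mean excess of the capped ratio of those who are selected over the capped ratio of those
who get their first choice, on the event that some estimated utility exceeds `β`. -/
noncomputable def cappedGap (k : Fin p → ℕ) (c β : ℝ) (x : Fin n → ℝ) (H : Finset (Fin n)) : ℝ :=
  {x : Fin n → ℝ | ∃ i, β < x i}.indicator (fun x => cappedRatio c (topSet (∑ a, k a) x) H -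
    ∫ s, cappedRatio c (firstChoosers k s (byDecreasing x) fun _ => none) H
      ∂(Measure.pi fun _ : Fin n => L)) x

lemma integral_cappedGap_nonneg {k : Fin p → ℕ} (hk : ∀ a, 0 < k a)
    (hK : ∑ a, k a ≤ n) (hK0 : 0 < ∑ a, k a) {c : ℝ} (hc : 0 ≤ c) {β : ℝ} (hβ : 0 < β)
    (hβ1 : β ≤ 1) (G₁ : Finset (Fin n)) :
    Integrable (fun u => cappedGap L k c β (estimated G₁ β u) G₁ᶜ) (unifLaw n) ∧
      0 ≤ ∫ u, cappedGap L k c β (estimated G₁ β u) G₁ᶜ ∂(unifLaw n) := by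
  unfold cappedGap
  refine integral_estimated_nonneg (g := fun x H => {x : Fin n → ℝ | ∃ i, β < x i}.indicator
    (fun x => cappedRatio c (topSet (∑ a, k a) x) H -
        ∫ s, cappedRatio c (firstChoosers k s (byDecreasing x) fun _ => none) H
          ∂(Measure.pi fun _ : Fin n => L)) x) hβ hβ1 ?_ ?_ (C := 1) ?_ G₁ᶜ.card ?_ G₁ rfl
  · intro e x hx H
    have hiff : (∃ i, β < (x ∘ e) i) ↔ ∃ i, β < x i :=
      ⟨fun ⟨i, hi⟩ => ⟨e i, hi⟩, fun ⟨i, hi⟩ => ⟨e.symm i, by simpa using hi⟩⟩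
    simp only [Set.indicator_apply, Set.mem_ofPred_eq, hiff, topSet_comp_perm _ hx,
      cappedRatio_map_symm]
    -- The lists are exchangeable too, so they can be relabelled together with the utilities.
    rw [← integral_comp_perm L e]
    simp only [firstChoosers_comp_perm k _ e hx, cappedRatio_map_symm]
  · intro H
    refine Measurable.indicator ?_ ?_
    · exact measurable_comp_byDecreasing (fun l => cappedRatio c (l.take (∑ a, k a)).toFinset H -
        ∫ s, cappedRatio c (firstChoosers k s l fun _ => none) H ∂(Measure.pi fun _ : Fin n => L))
    · have : {x : Fin n → ℝ | ∃ i, β < x i} = ⋃ i, {x | β < x i} := by ext; simp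
      rw [this]
      exact MeasurableSet.iUnion fun i => measurableSet_lt measurable_const (measurable_pi_apply i)
  · intro x H
    have h1 := cappedRatio_nonneg hc (topSet (∑ a, k a) x) H
    have h2 := cappedRatio_le_one c (topSet (∑ a, k a) x) H
    have h3 : 0 ≤ ∫ s, cappedRatio c (firstChoosers k s (byDecreasing x) fun _ => none) H
        ∂(Measure.pi fun _ : Fin n => L) := integral_nonneg fun s => cappedRatio_nonneg hc _ _
    have h4 : ∫ s, cappedRatio c (firstChoosers k s (byDecreasing x) fun _ => none) H
        ∂(Measure.pi fun _ : Fin n => L) ≤ 1 := by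
      refine (integral_mono Integrable.of_finite (integrable_const 1)
        fun s => cappedRatio_le_one c _ _).trans_eq (by simp)
    rw [Set.indicator_apply]
    split_ifs
    · rw [abs_le]; constructor <;> linarith
    · simp
  · intro x
    by_cases h : ∃ i, β < x i
    · simp only [Set.indicator_apply, Set.mem_ofPred_eq, h, if_true, Finset.sum_sub_distrib]
      exact sub_nonneg.2 (sum_integral_cappedRatio_le L hk hK hK0 hc _ x β h)
    · simp [h]

end Comparison

/-! ### Mean deviation of sums of independent bounded variables. -/

section Deviation

variable {n : ℕ}

/-- The deviation of a sum of functions of the utilities from its mean. -/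
noncomputable def sumDev (w : Fin n → ℝ → ℝ) (u : Fin n → ℝ) : ℝ :=
  |∑ i, w i (u i) - ∑ i, ∫ t, w i t ∂uniform01|

lemma integrable_sumDev_and_integral_le {w : Fin n → ℝ → ℝ} (hw : ∀ i, Measurable (w i))
    (h0 : ∀ i t, 0 ≤ w i t) (h1 : ∀ i t, w i t ≤ 1) :
    Integrable (sumDev w) (unifLaw n) ∧ ∫ u, sumDev w u ∂(unifLaw n) ≤ Real.sqrt n := by
  rcases n.eq_zero_or_pos with rfl | hn
  · have : sumDev w = 0 := by ext; simp [sumDev]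
    rw [this]
    exact ⟨integrable_zero _ _ _, by simp⟩
  have hwb : ∀ i t, ‖w i t‖ ≤ 1 := fun i t => by
    rw [Real.norm_eq_abs, abs_of_nonneg (h0 i t)]; exact h1 i t
  have hmem : ∀ i, MemLp (w i) 2 uniform01 := fun i =>
    MemLp.of_bound (hw i).aestronglyMeasurable 1 (Filter.Eventually.of_forall (hwb i))
  have hsm : Measurable fun u : Fin n → ℝ => ∑ i, w i (u i) :=
    Finset.measurable_fun_sum _ fun i _ => (hw i).comp (measurable_pi_apply i)
  have hsb : ∀ u : Fin n → ℝ, ‖∑ i, w i (u i)‖ ≤ n := fun u => by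
    refine (norm_sum_le _ _).trans ((Finset.sum_le_sum fun i _ => hwb i (u i)).trans_eq (by simp))
  have hmean : ∫ u, ∑ i, w i (u i) ∂(unifLaw n) = ∑ i, ∫ t, w i t ∂uniform01 := by
    rw [integral_finsetSum]
    · refine Finset.sum_congr rfl fun i _ => ?_
      exact integral_comp_eval (μ := fun _ : Fin n => uniform01) (f := w i)
        (hw i).aestronglyMeasurable
    · intro i _
      exact Integrable.of_bound ((hw i).comp (measurable_pi_apply i)).aestronglyMeasurable 1
        (Filter.Eventually.of_forall fun u => hwb i (u i))
  set c := ∑ i, ∫ t, w i t ∂uniform01 with hc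
  have hdm : Measurable fun u : Fin n → ℝ => ∑ i, w i (u i) - c := hsm.sub_const c
  have hdb : ∀ u : Fin n → ℝ, ‖∑ i, w i (u i) - c‖ ≤ n + |c| := fun u =>
    (norm_sub_le _ _).trans (add_le_add (hsb u) le_rfl)
  have hint : Integrable (sumDev w) (unifLaw n) :=
    (Integrable.of_bound hdm.aestronglyMeasurable _ (Filter.Eventually.of_forall hdb)).abs
  refine ⟨hint, ?_⟩
  have hint2 : Integrable (fun u : Fin n → ℝ => (∑ i, w i (u i) - c) ^ 2) (unifLaw n) := by
    refine Integrable.of_bound (hdm.pow_const 2).aestronglyMeasurable ((n + |c|) ^ 2)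
      (Filter.Eventually.of_forall fun u => ?_)
    rw [norm_pow]
    gcongr
    exact hdb u
  have hvar : ∫ u, (∑ i, w i (u i) - c) ^ 2 ∂(unifLaw n) ≤ n := by
    have h := ProbabilityTheory.variance_sum_pi (μ := fun _ : Fin n => uniform01) (X := w) hmem
    rw [ProbabilityTheory.variance_eq_integral
      (by simpa only [Finset.sum_fn] using hsm.aemeasurable)] at h
    simp only [Finset.sum_apply] at h
    change ∫ u, (∑ i, w i (u i) - ∫ u, ∑ i, w i (u i) ∂(unifLaw n)) ^ 2 ∂(unifLaw n) = _ at h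
    rw [hmean] at h
    rw [h]
    calc _ ≤ ∑ i : Fin n, (1 : ℝ) := Finset.sum_le_sum fun i _ => ?_
      _ = n := by simp
    refine (ProbabilityTheory.variance_le_expectation_sq (hw i).aestronglyMeasurable).trans ?_
    refine (integral_mono_of_nonneg (Filter.Eventually.of_forall fun t => sq_nonneg _)
      (integrable_const (1 : ℝ)) (Filter.Eventually.of_forall fun t => ?_)).trans_eq (by simp)
    exact pow_le_one₀ (h0 i t) (h1 i t)
  have hs : 0 < Real.sqrt n := Real.sqrt_pos.2 (by exact_mod_cast hn)
  have hss : Real.sqrt n * Real.sqrt n = n := Real.mul_self_sqrt (Nat.cast_nonneg _)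
  -- `y ≤ y² / (2√n) + √n / 2` turns the variance bound `n` into the first-moment bound `√n`.
  have hpt : ∀ u, sumDev w u ≤
      (2 * Real.sqrt n)⁻¹ * (∑ i, w i (u i) - c) ^ 2 + Real.sqrt n / 2 := by
    intro u
    rw [sumDev, ← sq_abs (∑ i, w i (u i) - c)]
    set y := |∑ i, w i (u i) - c|
    have : (2 * Real.sqrt n)⁻¹ * y ^ 2 + Real.sqrt n / 2 - y =
        (2 * Real.sqrt n)⁻¹ * (y - Real.sqrt n) ^ 2 := by field_simp; ring
    have h2 : 0 ≤ (2 * Real.sqrt n)⁻¹ * (y - Real.sqrt n) ^ 2 := by positivity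
    linarith
  calc ∫ u, sumDev w u ∂(unifLaw n)
      ≤ ∫ u, ((2 * Real.sqrt n)⁻¹ * (∑ i, w i (u i) - c) ^ 2 + Real.sqrt n / 2) ∂(unifLaw n) :=
        integral_mono hint ((hint2.const_mul _).add (integrable_const _)) hpt
    _ = (2 * Real.sqrt n)⁻¹ * ∫ u, (∑ i, w i (u i) - c) ^ 2 ∂(unifLaw n) + Real.sqrt n / 2 := by
        rw [integral_add (hint2.const_mul _) (integrable_const _), integral_const_mul]
        simp
    _ ≤ (2 * Real.sqrt n)⁻¹ * n + Real.sqrt n / 2 := by gcongr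
    _ = Real.sqrt n := by
        nth_rewrite 2 [← hss]
        field_simp; ring

lemma integral_indicator_Ioi {θ : ℝ} (h0 : 0 ≤ θ) (h1 : θ ≤ 1) :
    ∫ t, (if θ < t then (1 : ℝ) else 0) ∂uniform01 = 1 - θ := by
  have : (fun t : ℝ => if θ < t then (1 : ℝ) else 0) = (Set.Ioi θ).indicator fun _ => 1 := by
    ext t; simp [Set.indicator_apply]
  rw [this, integral_indicator measurableSet_Ioi, uniform01,
    Measure.restrict_restrict measurableSet_Ioi]
  have hs : Set.Ioi θ ∩ Set.Icc 0 1 = Set.Ioc θ 1 := by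
    ext t
    simp only [Set.mem_inter_iff, Set.mem_Ioi, Set.mem_Icc, Set.mem_Ioc]
    constructor
    · exact fun h => ⟨h.1, h.2.2⟩
    · exact fun h => ⟨h.1, by linarith, h.2⟩
  rw [hs]
  simp [Measure.real, h1]

lemma integral_id_indicator_Ioi {θ : ℝ} (h0 : 0 ≤ θ) (h1 : θ ≤ 1) :
    ∫ t, (if θ < t ∧ t ≤ 1 then t else 0) ∂uniform01 = (1 - θ ^ 2) / 2 := by
  have : (fun t : ℝ => if θ < t ∧ t ≤ 1 then t else 0) = (Set.Ioc θ 1).indicator fun t => t := by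
    ext t; simp [Set.indicator_apply]
  rw [this, integral_indicator measurableSet_Ioc, uniform01,
    Measure.restrict_restrict measurableSet_Ioc]
  have hs : Set.Ioc θ 1 ∩ Set.Icc 0 1 = Set.Ioc θ 1 := by
    rw [Set.inter_eq_left]
    exact fun t h => ⟨by linarith [h.1], h.2⟩
  rw [hs, ← intervalIntegral.integral_of_le h1, integral_id]
  ring

end Deviation

/-! ### Limiting rates and elementary estimates. -/

section Numeric

/-- The limiting selection rates `r₁`, `r₂` of the two groups, and the fact that they correspond to
a common threshold `1 - r₁` for the estimated utilities. -/
lemma exists_rates {n₁ n₂ K β : ℝ} (h1 : 0 < n₁) (h2 : 0 < n₂) (hK0 : 0 < K)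
    (hK : K ≤ n₁ + n₂) (hβ : 0 < β) (hβ1 : β ≤ 1) :
    ∃ r₁ r₂ : ℝ, alphaOne n₁ n₂ K β = n₁ * r₁ ∧ alphaTwo n₁ n₂ K β = n₂ * r₂ ∧ 0 ≤ r₂ ∧ r₂ ≤ r₁ ∧
      r₁ ≤ 1 ∧ fairValue n₁ n₂ K β = r₂ / r₁ ∧
      ∀ u : ℝ, u ≤ 1 → (1 - r₁ < β * u ↔ 1 - r₂ < u) := by
  have hD : 0 < β * n₁ + n₂ := by positivity
  have hE : 0 < K * β + n₂ * (1 - β) :=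
    add_pos_of_pos_of_nonneg (by positivity) (mul_nonneg h2.le (by linarith))
  -- In the first case the rates solve `n₁r₁ + n₂r₂ = K`, `1 - r₁ = β(1 - r₂)`. In the second the
  -- cut `1 - K/n₁` is at least `β`, so no member of `G₂` passes and `r₂ = 0`.
  rcases le_total ((1 - β) * n₁) K with h | h
  · have hmax : max (K - (1 - β) * n₁) 0 = K - (1 - β) * n₁ := max_eq_left (by linarith)
    refine ⟨(K * β + n₂ * (1 - β)) / (β * n₁ + n₂), (K - (1 - β) * n₁) / (β * n₁ + n₂), ?_, ?_, ?_,
      ?_, ?_, ?_, ?_⟩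
    · rw [alphaOne, hmax]; field_simp; ring
    · rw [alphaTwo, alphaOne, hmax]; field_simp; ring
    · exact div_nonneg (by linarith) hD.le
    · refine (div_le_div_iff_of_pos_right hD).2 ?_
      nlinarith [mul_nonneg (sub_nonneg.2 hβ1) (sub_nonneg.2 hK)]
    · rw [div_le_one hD]; nlinarith
    · rw [fairValue, max_eq_left (div_nonneg (by linarith) hE.le)]
      field_simp
    · intro u _
      have : 1 - (K * β + n₂ * (1 - β)) / (β * n₁ + n₂) =
          β * (1 - (K - (1 - β) * n₁) / (β * n₁ + n₂)) := by field_simp; ring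
      rw [this]
      exact mul_lt_mul_iff_right₀ hβ
  · have hmax : max (K - (1 - β) * n₁) 0 = 0 := max_eq_right (by linarith)
    refine ⟨K / n₁, 0, ?_, ?_, le_rfl, by positivity, ?_, ?_, ?_⟩
    · rw [alphaOne, hmax]; field_simp; ring
    · rw [alphaTwo, alphaOne, hmax]; ring
    · rw [div_le_one h1]; nlinarith
    · rw [fairValue, max_eq_right (div_nonpos_of_nonpos_of_nonneg (by linarith) hE.le)]
      simp
    · intro u hu
      refine iff_of_false ?_ (by linarith)
      have : K / n₁ ≤ 1 - β := by rw [div_le_iff₀ h1]; exact h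
      nlinarith

/-- Compares the order-statistics mean with the mean total utility above the cut `1 - r`; they
differ by `n r (1 - r) / (2 (n + 1))`. -/
lemma abs_topMean_sub_le {n r : ℝ} (hn : 0 ≤ n) (h0 : 0 ≤ r) (h1 : r ≤ 1) :
    |topMean (n * r) n - n * (1 - (1 - r) ^ 2) / 2| ≤ 1 := by
  have : topMean (n * r) n - n * (1 - (1 - r) ^ 2) / 2 = - (n * (r * (1 - r)) / (2 * (n + 1))) := by
    rw [topMean]; field_simp; ring
  rw [this, abs_neg, abs_of_nonneg (by
    have := sub_nonneg.2 h1
    positivity), div_le_one (by positivity)]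
  nlinarith [mul_nonneg h0 (sub_nonneg.2 h1)]

lemma half_le_topMean {n K : ℝ} (hK0 : 0 ≤ K) (hK : K ≤ n) : K / 2 ≤ topMean K n := by
  have hn : 0 < n + 1 := by linarith
  have : topMean K n - K / 2 = K * (n - K) / (2 * (n + 1)) := by
    rw [topMean]; field_simp; ring
  have h2 : 0 ≤ K * (n - K) / (2 * (n + 1)) :=
    div_nonneg (mul_nonneg hK0 (by linarith)) (by linarith)
  linarith

/-- Since `m / a ≤ 1`, no lower bound on the random denominator `a` is needed. For `a = 0` the
quotient is `0` by convention, and then `c ≤ δ`. -/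
lemma abs_div_sub_le {m a c d δ : ℝ} (hm0 : 0 ≤ m) (hma : m ≤ a) (hc : 0 < c)
    (hdc : d ≤ c) (hd : 0 ≤ d) (h1 : |m - d| ≤ δ) (h2 : |a - c| ≤ δ) :
    |m / a - d / c| ≤ 2 * δ / c := by
  rcases (hm0.trans hma).eq_or_lt with h | h
  · subst h
    rw [div_zero, zero_sub, abs_neg, abs_of_nonneg (by positivity)]
    have : c ≤ δ := by simpa [abs_of_pos hc] using h2
    gcongr
    linarith
  · have : m / a - d / c = ((m - d) + m / a * (c - a)) / c := by field_simp; ring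
    rw [this, abs_div, abs_of_pos hc]
    gcongr
    refine (abs_add_le _ _).trans ?_
    rw [abs_mul, abs_of_nonneg (by positivity : 0 ≤ m / a), abs_sub_comm c a]
    have h3 : m / a ≤ 1 := (div_le_one h).2 hma
    have h4 : m / a * |a - c| ≤ 1 * δ := mul_le_mul h3 h2 (abs_nonneg _) zero_le_one
    linarith

lemma abs_min_sub_le {a b c d δ : ℝ} (ha : |a - c| ≤ δ) (hb : |b - d| ≤ δ) (hdc : d ≤ c) :
    |min a b - d| ≤ δ := by
  rw [abs_le] at *
  constructor
  · rcases min_choice a b with h | h <;> rw [h] <;> linarith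
  · linarith [min_le_right a b]

lemma abs_max_sub_le {a b c d δ : ℝ} (ha : |a - c| ≤ δ) (hb : |b - d| ≤ δ) (hdc : d ≤ c) :
    |max a b - c| ≤ δ := by
  rw [abs_le] at *
  constructor
  · linarith [le_max_left a b]
  · rcases max_choice a b with h | h <;> rw [h] <;> linarith

/-- A bound on the probability that no advantaged candidate has a utility above `β`. -/
lemma one_sub_fairValue_mul_pow_le {n₁ : ℕ} {n₂ K β η₁ η₂ : ℝ} (h1 : 0 < n₁) (h2 : 0 < n₂)
    (hK : K ≤ n₁ + n₂) (hβ : 0 < β) (hβ1 : β ≤ 1) (hη₁ : 0 < η₁)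
    (hη₂ : 0 < η₂) (hn₁ : η₁ * (n₁ + n₂) ≤ n₁) (hKη : η₂ * (n₁ + n₂) ≤ K) :
    (1 - fairValue n₁ n₂ K β) * β ^ n₁ ≤ 2 / (η₁ * η₂ * (n₁ + n₂)) := by
  have h1' : (0 : ℝ) < n₁ := by exact_mod_cast h1
  set N : ℝ := n₁ + n₂ with hN
  have hNpos : 0 < N := by positivity
  have hKpos : 0 < K := lt_of_lt_of_le (by positivity) hKη
  have hη₁1 : η₁ ≤ 1 := by
    by_contra! h
    nlinarith
  set y : ℝ := n₁ * (1 - β) with hy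
  have hy0 : 0 ≤ y := mul_nonneg h1'.le (by linarith)
  have hP0 : 0 ≤ β ^ n₁ := by positivity
  -- `1 + y ≤ exp y`, while `β ≤ exp (-(1 - β))` gives `β ^ n₁ ≤ exp (-y)`.
  have hP : (1 + y) * β ^ n₁ ≤ 1 := by
    have e1 : 1 + y ≤ Real.exp y := by linarith [Real.add_one_le_exp y]
    have e2 : β ≤ Real.exp (-(1 - β)) := by linarith [Real.add_one_le_exp (-(1 - β))]
    calc (1 + y) * β ^ n₁ ≤ Real.exp y * Real.exp (-(1 - β)) ^ n₁ := by gcongr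
      _ = 1 := by rw [← Real.exp_nat_mul, ← Real.exp_add, hy, mul_neg, add_neg_cancel,
            Real.exp_zero]
  have hv0 : 0 ≤ fairValue n₁ n₂ K β := le_max_right _ _
  rw [le_div_iff₀ (by positivity)]
  have hηηN : η₁ * η₂ * N ≤ K := by nlinarith [mul_pos hη₂ hNpos]
  -- For large `y` the power alone is small; for small `y` the factor `1 - v` is of order `N (1 - β)
  -- / K`, and `n₁ (1 - β) β ^ n₁ ≤ 1`.
  rcases le_total (K / 2) y with h | h
  · have e1 : K / 2 * β ^ n₁ ≤ 1 := by nlinarith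
    calc (1 - fairValue n₁ n₂ K β) * β ^ n₁ * (η₁ * η₂ * N) ≤ 1 * β ^ n₁ * K := by
          gcongr
          linarith
      _ ≤ 2 := by linarith
  · have hE : K / 2 ≤ K * β + n₂ * (1 - β) := by nlinarith
    have hE0 : 0 < K * β + n₂ * (1 - β) := by linarith
    have hv : 1 - fairValue n₁ n₂ K β ≤ N * (1 - β) / (K / 2) := by
      have e1 : (K - n₁ * (1 - β)) / (K * β + n₂ * (1 - β)) ≤ fairValue n₁ n₂ K β := le_max_left _ _
      have e2 : 1 - (K - n₁ * (1 - β)) / (K * β + n₂ * (1 - β)) =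
          (N - K) * (1 - β) / (K * β + n₂ * (1 - β)) := by
        rw [hN, eq_div_iff hE0.ne', sub_mul, div_mul_cancel₀ _ hE0.ne']; ring
      have e3 : (N - K) * (1 - β) / (K * β + n₂ * (1 - β)) ≤ N * (1 - β) / (K / 2) := by
        have := sub_nonneg.2 hβ1
        gcongr
        linarith
      linarith
    have e4 : η₁ * N * ((1 - β) * β ^ n₁) ≤ 1 := by
      calc η₁ * N * ((1 - β) * β ^ n₁) ≤ n₁ * ((1 - β) * β ^ n₁) :=
            mul_le_mul_of_nonneg_right hn₁ (mul_nonneg (by linarith) hP0)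
        _ ≤ 1 := by nlinarith
    calc (1 - fairValue n₁ n₂ K β) * β ^ n₁ * (η₁ * η₂ * N)
        ≤ N * (1 - β) / (K / 2) * β ^ n₁ * (η₁ * η₂ * N) := by gcongr
      _ = 2 * (η₂ * N / K) * (η₁ * N * ((1 - β) * β ^ n₁)) := by field_simp
      _ ≤ 2 * 1 * 1 := by
          have e5 := (div_le_one hKpos).2 hKη
          have e6 : 0 ≤ η₂ * N / K := by positivity
          refine mul_le_mul (by linarith) e4 ?_ (by norm_num)
          exact mul_nonneg (by positivity) (mul_nonneg (by linarith) hP0)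
      _ = 2 := by norm_num

end Numeric

/-! ### Group ratios and capped ratios. -/

section Ratios

variable {n : ℕ}

lemma frac_nonneg (S G : Finset (Fin n)) : 0 ≤ frac S G := by unfold frac; positivity

lemma groupRatio_nonneg (G S : Finset (Fin n)) : 0 ≤ groupRatio G S :=
  div_nonneg (le_min (frac_nonneg _ _) (frac_nonneg _ _)) (le_max_of_le_left (frac_nonneg _ _))

lemma groupRatio_le_one (G S : Finset (Fin n)) : groupRatio G S ≤ 1 :=
  div_le_one_of_le₀ min_le_max (le_max_of_le_left (frac_nonneg _ _))

/-- The capped ratio in terms of selection rates. -/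
lemma cappedRatio_eq (G S : Finset (Fin n)) (hG : 0 < G.card) (hG' : 0 < Gᶜ.card) :
    cappedRatio (G.card / Gᶜ.card) S Gᶜ = min (frac S G) (frac S Gᶜ) / frac S G := by
  have hg : (0 : ℝ) < G.card := by exact_mod_cast hG
  have hg' : (0 : ℝ) < Gᶜ.card := by exact_mod_cast hG'
  have hS : S \ Gᶜ = S ∩ G := by ext; simp
  have e : (G.card : ℝ) / Gᶜ.card * (((S ∩ Gᶜ).card : ℝ) / (S ∩ G).card) =
      frac S Gᶜ / frac S G := by
    unfold frac
    rw [div_div_div_eq, div_mul_div_comm, mul_comm (G.card : ℝ)]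
  rw [cappedRatio, hS, e]
  rcases (frac_nonneg S G).eq_or_lt with h | h
  · simp [← h]
  · rw [← min_div_div_right h.le, div_self h.ne']

/-- The larger rate is replaced by that of `G`. If the latter is zero, both sides vanish. -/
lemma groupRatio_le_cappedRatio (G S : Finset (Fin n)) (hG : 0 < G.card) (hG' : 0 < Gᶜ.card) :
    groupRatio G S ≤ cappedRatio (G.card / Gᶜ.card) S Gᶜ := by
  rw [cappedRatio_eq G S hG hG', groupRatio]
  rcases (frac_nonneg S G).eq_or_lt with h | h
  · rw [← h, min_eq_left (frac_nonneg _ _)]; simp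
  · have := frac_nonneg S Gᶜ
    gcongr
    exact le_max_left _ _

end Ratios

/-! ### Concentration of counts and utilities of the top set. -/

section Concentration

variable {n : ℕ}

/-- Weights counting the members of `G` whose utility exceeds `1 - r`. -/
noncomputable def countWeight (G : Finset (Fin n)) (r : ℝ) (i : Fin n) (t : ℝ) : ℝ :=
  if i ∈ G ∧ 1 - r < t then 1 else 0

/-- Weights summing the utilities exceeding `1 - r₁` in `G`, and `1 - r₂` outside of `G`. -/
noncomputable def utilWeight (G : Finset (Fin n)) (r₁ r₂ : ℝ) (i : Fin n) (t : ℝ) : ℝ :=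
  -- The cutoff `t ≤ 1` bounds the weight for every real `t`; it is vacuous on `[0,1]`.
  if 1 - (if i ∈ G then r₁ else r₂) < t ∧ t ≤ 1 then t else 0

/-- The total deviation of the counts and the utilities above the thresholds. -/
noncomputable def countDev (G : Finset (Fin n)) (r₁ r₂ : ℝ) (u : Fin n → ℝ) : ℝ :=
  sumDev (countWeight G r₁) u + sumDev (countWeight Gᶜ r₂) u

lemma countDev_nonneg (G : Finset (Fin n)) (r₁ r₂ : ℝ) (u : Fin n → ℝ) : 0 ≤ countDev G r₁ r₂ u :=
  add_nonneg (abs_nonneg _) (abs_nonneg _)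

lemma integrable_sumDev_countWeight (G : Finset (Fin n)) (r : ℝ) :
    Integrable (sumDev (countWeight G r)) (unifLaw n) ∧
      ∫ u, sumDev (countWeight G r) u ∂(unifLaw n) ≤ Real.sqrt n := by
  refine integrable_sumDev_and_integral_le (fun i => ?_) (fun i t => ?_) (fun i t => ?_)
  · by_cases h : i ∈ G
    · unfold countWeight
      simp only [h, true_and]
      exact Measurable.ite measurableSet_Ioi measurable_const measurable_const
    · unfold countWeight
      simp only [h, false_and, if_false]
      exact measurable_const
  · unfold countWeight; split_ifs <;> simp
  · unfold countWeight; split_ifs <;> simp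

lemma integrable_countDev (G : Finset (Fin n)) (r₁ r₂ : ℝ) :
    Integrable (countDev G r₁ r₂) (unifLaw n) ∧
      ∫ u, countDev G r₁ r₂ u ∂(unifLaw n) ≤ 2 * Real.sqrt n := by
  have h1 := integrable_sumDev_countWeight G r₁
  have h2 := integrable_sumDev_countWeight Gᶜ r₂
  refine ⟨h1.1.add h2.1, ?_⟩
  unfold countDev
  rw [integral_add h1.1 h2.1]
  linarith [h1.2, h2.2]

lemma integrable_sumDev_utilWeight (G : Finset (Fin n)) {r₁ r₂ : ℝ} (h1 : r₁ ≤ 1) (h2 : r₂ ≤ 1) :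
    Integrable (sumDev (utilWeight G r₁ r₂)) (unifLaw n) ∧
      ∫ u, sumDev (utilWeight G r₁ r₂) u ∂(unifLaw n) ≤ Real.sqrt n := by
  refine integrable_sumDev_and_integral_le (fun i => ?_) (fun i t => ?_) (fun i t => ?_)
  · exact Measurable.ite measurableSet_Ioc measurable_id measurable_const
  · unfold utilWeight
    split_ifs with h h' <;> first | linarith [h'.1] | linarith
  · unfold utilWeight
    split_ifs with h h' <;> first | linarith [h'.2] | linarith

lemma sum_integral_countWeight (G : Finset (Fin n)) {r : ℝ} (h0 : 0 ≤ r) (h1 : r ≤ 1) :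
    ∑ i, ∫ t, countWeight G r i t ∂uniform01 = G.card * r := by
  have : ∀ i, ∫ t, countWeight G r i t ∂uniform01 = if i ∈ G then r else 0 := by
    intro i
    by_cases h : i ∈ G
    · simp only [countWeight, h, true_and, if_true]
      rw [integral_indicator_Ioi (by linarith) (by linarith)]; ring
    · simp [countWeight, h]
  simp [this]

lemma sum_integral_utilWeight (G : Finset (Fin n)) {r₁ r₂ : ℝ} (h0 : 0 ≤ r₁) (h1 : r₁ ≤ 1)
    (h0' : 0 ≤ r₂) (h1' : r₂ ≤ 1) :
    ∑ i, ∫ t, utilWeight G r₁ r₂ i t ∂uniform01 =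
      G.card * (1 - (1 - r₁) ^ 2) / 2 + Gᶜ.card * (1 - (1 - r₂) ^ 2) / 2 := by
  have : ∀ i, ∫ t, utilWeight G r₁ r₂ i t ∂uniform01 =
      if i ∈ G then (1 - (1 - r₁) ^ 2) / 2 else (1 - (1 - r₂) ^ 2) / 2 := by
    intro i
    unfold utilWeight
    rw [integral_id_indicator_Ioi]
    · split_ifs <;> rfl
    · split_ifs <;> linarith
    · split_ifs <;> linarith
  simp_rw [this]
  rw [Finset.sum_ite, Finset.sum_const, Finset.sum_const, nsmul_eq_mul, nsmul_eq_mul]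
  have e1 : (Finset.univ.filter fun i => i ∈ G) = G := by ext; simp
  have e2 : (Finset.univ.filter fun i => i ∉ G) = Gᶜ := by ext; simp
  rw [e1, e2]
  ring

/-- The number of selected members of the groups, and the utility of the selection, in terms of
the deviations at the limiting threshold. -/
lemma IsTop.abs_card_sub_le {G S : Finset (Fin n)} {K : ℕ} {β r₁ r₂ : ℝ} (h0 : 0 ≤ r₁) (h1 : r₁ ≤ 1)
    (h0' : 0 ≤ r₂) (h1' : r₂ ≤ 1) (hK : (K : ℝ) = G.card * r₁ + Gᶜ.card * r₂)
    (hthr : ∀ u : ℝ, u ≤ 1 → (1 - r₁ < β * u ↔ 1 - r₂ < u)) {u : Fin n → ℝ}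
    (hu : ∀ i, u i ∈ Set.Icc (0 : ℝ) 1) (hS : IsTop K (estimated G β u) S) :
    |((S ∩ G).card : ℝ) - G.card * r₁| ≤ 2 * countDev G r₁ r₂ u ∧
    |((S ∩ Gᶜ).card : ℝ) - Gᶜ.card * r₂| ≤ 2 * countDev G r₁ r₂ u ∧
    |∑ i ∈ S, u i - (G.card * (1 - (1 - r₁) ^ 2) / 2 + Gᶜ.card * (1 - (1 - r₂) ^ 2) / 2)| ≤
      countDev G r₁ r₂ u + sumDev (utilWeight G r₁ r₂) u := by
  set Q := Finset.univ.filter (fun i => 1 - r₁ < estimated G β u i) with hQ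
  have hmemQ : ∀ i, i ∈ Q ↔ 1 - (if i ∈ G then r₁ else r₂) < u i := by
    intro i
    rw [hQ, Finset.mem_filter, estimated]
    by_cases h : i ∈ G
    · simp [h]
    · simp only [h, if_false, Finset.mem_univ, true_and]
      exact hthr _ (hu i).2
  have hY1 : ((Q ∩ G).card : ℝ) = ∑ i, countWeight G r₁ i (u i) := by
    have : Q ∩ G = Finset.univ.filter (fun i => i ∈ G ∧ 1 - r₁ < u i) := by
      ext i
      simp only [Finset.mem_inter, hmemQ, Finset.mem_filter, Finset.mem_univ, true_and]
      by_cases h : i ∈ G <;> simp [h]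
    rw [this, Finset.card_filter]
    push_cast
    rfl
  have hY2 : ((Q ∩ Gᶜ).card : ℝ) = ∑ i, countWeight Gᶜ r₂ i (u i) := by
    have : Q ∩ Gᶜ = Finset.univ.filter (fun i => i ∈ Gᶜ ∧ 1 - r₂ < u i) := by
      ext i
      simp only [Finset.mem_inter, hmemQ, Finset.mem_filter, Finset.mem_univ, true_and,
        Finset.mem_compl]
      by_cases h : i ∈ G <;> simp [h]
    rw [this, Finset.card_filter]
    push_cast
    rfl
  have hY3 : ∑ i ∈ Q, u i = ∑ i, utilWeight G r₁ r₂ i (u i) := by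
    rw [← Finset.sum_filter_add_sum_filter_not Finset.univ (fun i => i ∈ Q)]
    have e1 : (Finset.univ.filter fun i => i ∈ Q) = Q := by ext; simp
    rw [e1, Finset.sum_eq_zero (s := Finset.univ.filter fun i => i ∉ Q), add_zero]
    · refine Finset.sum_congr rfl fun i hi => ?_
      rw [utilWeight, if_pos ⟨(hmemQ i).1 hi, (hu i).2⟩]
    · intro i hi
      rw [utilWeight, if_neg]
      exact fun h => (Finset.mem_filter.1 hi).2 ((hmemQ i).2 h.1)
  have hQcard : (Q.card : ℝ) = (Q ∩ G).card + (Q ∩ Gᶜ).card := by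
    rw [← Finset.sdiff_eq_inter_compl]
    exact_mod_cast (Finset.card_inter_add_card_sdiff Q G).symm
  have hd1 : |((Q ∩ G).card : ℝ) - G.card * r₁| = sumDev (countWeight G r₁) u := by
    rw [sumDev, hY1, sum_integral_countWeight G h0 h1]
  have hd2 : |((Q ∩ Gᶜ).card : ℝ) - Gᶜ.card * r₂| = sumDev (countWeight Gᶜ r₂) u := by
    rw [sumDev, hY2, sum_integral_countWeight Gᶜ h0' h1']
  have hd3 : |∑ i ∈ Q, u i - (G.card * (1 - (1 - r₁) ^ 2) / 2 + Gᶜ.card * (1 - (1 - r₂) ^ 2) / 2)| =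
      sumDev (utilWeight G r₁ r₂) u := by
    rw [sumDev, hY3, sum_integral_utilWeight G h0 h1 h0' h1']
  -- `K` is the mean size of `Q`.
  have hKQ : |(K : ℝ) - Q.card| ≤ countDev G r₁ r₂ u := by
    rw [countDev, ← hd1, ← hd2, abs_sub_comm, hQcard, hK]
    refine le_trans (le_of_eq ?_) (abs_add_le _ _)
    congr 1; ring
  have hcount : ∀ H : Finset (Fin n), |((S ∩ H).card : ℝ) - (Q ∩ H).card| ≤ countDev G r₁ r₂ u := by
    intro H
    have h := hS.abs_sum_sub_le (1 - r₁) (fun i => if i ∈ H then 1 else 0)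
      (fun i => by split_ifs <;> simp) (fun i => by split_ifs <;> simp)
    refine le_trans (le_of_eq ?_) (h.trans hKQ)
    simp [hQ]
  have hutil := (hS.abs_sum_sub_le (1 - r₁) u (fun i => (hu i).1) fun i => (hu i).2).trans hKQ
  have hp1 : 0 ≤ sumDev (countWeight G r₁) u := abs_nonneg _
  have hp2 : 0 ≤ sumDev (countWeight Gᶜ r₂) u := abs_nonneg _
  have hdev : countDev G r₁ r₂ u = sumDev (countWeight G r₁) u + sumDev (countWeight Gᶜ r₂) u := rfl
  refine ⟨?_, ?_, ?_⟩
  · have := abs_sub_le ((S ∩ G).card : ℝ) (Q ∩ G).card (G.card * r₁)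
    linarith [hcount G]
  · have := abs_sub_le ((S ∩ Gᶜ).card : ℝ) (Q ∩ Gᶜ).card (Gᶜ.card * r₂)
    linarith [hcount Gᶜ]
  · refine (abs_sub_le _ (∑ i ∈ Q, u i) _).trans ?_
    linarith

end Concentration

/-! ### Integrability and the limiting data of the model. -/

section Main

variable {n p : ℕ}

lemma law_eq (L : Measure (PrefList p)) :
    law n uniform01 L = (unifLaw n).prod (Measure.pi fun _ : Fin n => L) := rfl

lemma ae_law_of_ae (L : Measure (PrefList p)) {P : (Fin n → ℝ) → Prop}
    (h : ∀ᵐ u ∂(unifLaw n), P u) : ∀ᵐ w ∂(law n uniform01 L), P w.1 :=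
  Measure.quasiMeasurePreserving_fst.ae h

variable (L : Measure (PrefList p)) [IsProbabilityMeasure L]

instance : IsProbabilityMeasure (law n uniform01 L) := by unfold law; infer_instance

lemma integral_law_fst (f : (Fin n → ℝ) → ℝ) :
    ∫ w, f w.1 ∂(law n uniform01 L) = ∫ u, f u ∂(unifLaw n) := by
  rw [law_eq, integral_fun_fst]; simp

lemma integrable_law_fst {f : (Fin n → ℝ) → ℝ} (hf : Integrable f (unifLaw n)) :
    Integrable (fun w => f w.1) (law n uniform01 L) := hf.comp_fst _

/-- If a function of utilities and lists is within an integrable function `d` of a constant, then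
so is its mean within the mean of `d`. -/
lemma abs_integral_law_sub_le {f : (Fin n → ℝ) × (Fin n → PrefList p) → ℝ}
    (hf : Integrable f (law n uniform01 L)) {d : (Fin n → ℝ) → ℝ} (hd : Integrable d (unifLaw n))
    {c : ℝ} (h : ∀ᵐ w ∂(law n uniform01 L), |f w - c| ≤ d w.1) :
    |∫ w, f w ∂(law n uniform01 L) - c| ≤ ∫ u, d u ∂(unifLaw n) := by
  have : ∫ w, f w ∂(law n uniform01 L) - c = ∫ w, (f w - c) ∂(law n uniform01 L) := by
    rw [integral_sub hf (integrable_const _)]; simp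
  rw [this, ← integral_law_fst L d]
  exact (abs_integral_le_integral_abs).trans
    (integral_mono_ae (hf.sub (integrable_const _)).abs (integrable_law_fst L hd) h)

variable {k : Fin p → ℕ} {G₁ : Finset (Fin n)} {β : ℝ}

lemma estimated_pos (hβ : 0 < β) {u : Fin n → ℝ} (hu : ∀ i, 0 < u i) (i : Fin n) :
    0 < estimated G₁ β u i := by
  unfold estimated
  split_ifs
  exacts [hu i, mul_pos hβ (hu i)]

lemma estimated_one (u : Fin n → ℝ) : estimated G₁ 1 u = u := by
  ext i; simp [estimated]

lemma isTop_selected {A : Algorithm n p} (hA : MaximizesEstimatedUtility k A)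
    (hK : ∑ l, k l ≤ n) (hβ : 0 < β) {u : Fin n → ℝ} (hu : ∀ i, 0 < u i)
    (s : Fin n → PrefList p) :
    IsTop (∑ l, k l) (estimated G₁ β u) (selected (A (estimated G₁ β u) s)) := by
  have hpos := estimated_pos (G₁ := G₁) hβ hu
  obtain ⟨h1, h2⟩ := hA (estimated G₁ β u) (fun i => (hpos i).le) s
  exact isTop_selected_of_maximal hK hpos h1 h2

omit [IsProbabilityMeasure L] in
lemma ae_selected_eq {A : Algorithm n p} (hA : MaximizesEstimatedUtility k A)
    (hK : ∑ l, k l ≤ n) (hβ : 0 < β) :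
    ∀ᵐ w ∂(law n uniform01 L), selected (A (estimated G₁ β w.1) w.2) =
      topSet (∑ l, k l) (estimated G₁ β w.1) := by
  filter_upwards [ae_law_of_ae L ae_pos, ae_law_of_ae L (ae_estimated_injective G₁ hβ)]
    with w h1 h2
  exact (isTop_selected hA hK hβ h1 w.2).eq h2 (isTop_topSet hK _)

/-- `A` itself need not be measurable, but almost surely its selected set is the top set. -/
lemma integrable_repRatio {A : Algorithm n p} (hA : MaximizesEstimatedUtility k A)
    (hK : ∑ l, k l ≤ n) (hβ : 0 < β) : Integrable (repRatio A G₁ β) (law n uniform01 L) := by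
  have hm : Measurable fun w : (Fin n → ℝ) × (Fin n → PrefList p) =>
      groupRatio G₁ (topSet (∑ l, k l) (estimated G₁ β w.1)) :=
    (measurable_comp_byDecreasing fun l => groupRatio G₁ (l.take (∑ l, k l)).toFinset).comp
      ((measurable_estimated G₁ β).comp measurable_fst)
  have hi : Integrable (fun w : (Fin n → ℝ) × (Fin n → PrefList p) =>
      groupRatio G₁ (topSet (∑ l, k l) (estimated G₁ β w.1))) (law n uniform01 L) :=
    Integrable.of_bound hm.aestronglyMeasurable 1 (Filter.Eventually.of_forall fun w => by
      rw [Real.norm_eq_abs, abs_of_nonneg (groupRatio_nonneg _ _)]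
      exact groupRatio_le_one _ _)
  refine hi.congr ?_
  filter_upwards [ae_selected_eq L hA hK hβ] with w hw
  rw [repRatio, hw]

lemma topSum_nonneg {u : Fin n → ℝ} (hu : ∀ i, 0 ≤ u i) (K : ℕ) : 0 ≤ topSum K u := by
  rw [topSum_eq_sum]; exact Finset.sum_nonneg fun i _ => hu i

lemma utilRatio_mem_Icc {A : Algorithm n p} (hA : MaximizesEstimatedUtility k A)
    (hK : ∑ l, k l ≤ n) (hβ : 0 < β) {w : (Fin n → ℝ) × (Fin n → PrefList p)}
    (hu : ∀ i, 0 < w.1 i) : utilRatio k A G₁ β w ∈ Set.Icc (0 : ℝ) 1 := by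
  have h0 := topSum_nonneg (fun i => (hu i).le) (∑ l, k l)
  refine ⟨div_nonneg (Finset.sum_nonneg fun i _ => (hu i).le) h0, div_le_one_of_le₀ ?_ h0⟩
  rw [topSum_eq_sum]
  exact (isTop_topSet hK w.1).sum_le (fun i => (hu i).le) (isTop_selected hA hK hβ hu w.2).1.le

lemma measurable_sum_topSet (K : ℕ) (G₁ : Finset (Fin n)) (β : ℝ) :
    Measurable fun u : Fin n → ℝ => ∑ i ∈ topSet K (estimated G₁ β u), u i := by
  classical
  have : (fun u : Fin n → ℝ => ∑ i ∈ topSet K (estimated G₁ β u), u i) =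
      fun u => ∑ i, (if i ∈ topSet K (estimated G₁ β u) then 1 else 0) * u i := by
    ext u; simp
  rw [this]
  refine Finset.measurable_fun_sum _ fun i _ => Measurable.mul ?_ (measurable_pi_apply i)
  exact (measurable_comp_byDecreasing fun l => if i ∈ (l.take K).toFinset then (1 : ℝ) else 0).comp
    (measurable_estimated G₁ β)

lemma integrable_utilRatio {A : Algorithm n p} (hA : MaximizesEstimatedUtility k A)
    (hK : ∑ l, k l ≤ n) (hβ : 0 < β) : Integrable (utilRatio k A G₁ β) (law n uniform01 L) := by
  have hT : Measurable fun u : Fin n → ℝ => topSum (∑ l, k l) u := by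
    have := measurable_sum_topSet (∑ l, k l) G₁ 1
    simp only [estimated_one, ← topSum_eq_sum] at this
    exact this
  have hm : AEStronglyMeasurable (utilRatio k A G₁ β) (law n uniform01 L) := by
    refine AEStronglyMeasurable.congr (f := fun w : (Fin n → ℝ) × (Fin n → PrefList p) =>
      (∑ i ∈ topSet (∑ l, k l) (estimated G₁ β w.1), w.1 i) / topSum (∑ l, k l) w.1)
      (((measurable_sum_topSet _ G₁ β).comp measurable_fst).div
        (hT.comp measurable_fst)).aestronglyMeasurable ?_
    filter_upwards [ae_selected_eq L hA hK hβ] with w hw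
    rw [utilRatio, utility, hw]
  refine Integrable.of_bound hm 1 ?_
  filter_upwards [ae_law_of_ae L ae_pos] with w hw
  obtain ⟨h1, h2⟩ := utilRatio_mem_Icc (G₁ := G₁) hA hK hβ hw
  rw [Real.norm_eq_abs, abs_of_nonneg h1]
  exact h2

lemma integrable_prefRatio : Integrable (prefRatio (stableAlg k) G₁ β) (law n uniform01 L) := by
  refine Integrable.of_bound ?_ 1 (Filter.Eventually.of_forall fun w => by
      rw [Real.norm_eq_abs, prefRatio, abs_of_nonneg (groupRatio_nonneg _ _)]
      exact groupRatio_le_one _ _)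
  unfold prefRatio
  simp_rw [gotFirst_stableAlg]
  exact ((measurable_comp_byDecreasing_prod fun l s =>
    groupRatio G₁ (firstChoosers k s l fun _ => none)).comp
      (((measurable_estimated G₁ β).comp measurable_fst).prodMk
        measurable_snd)).aestronglyMeasurable

/-- Deviations of the selection rates. -/
lemma abs_frac_sub_le {S G : Finset (Fin n)} {r δ N : ℝ} (hN : 0 < N) (hG : N ≤ G.card)
    (h : |((S ∩ G).card : ℝ) - G.card * r| ≤ δ) : |frac S G - r| ≤ δ / N := by
  have hG0 : (0 : ℝ) < G.card := hN.trans_le hG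
  have : frac S G - r = (((S ∩ G).card : ℝ) - G.card * r) / G.card := by
    unfold frac; field_simp
  rw [this, abs_div, abs_of_pos hG0]
  have hδ : 0 ≤ δ := (abs_nonneg _).trans h
  gcongr

lemma sqrt_log_ge {n : ℕ} (hn : 2 ≤ n) : 1 / 2 ≤ Real.sqrt (Real.log n) := by
  refine Real.le_sqrt_of_sq_le ?_
  have h1 : Real.log 2 ≤ Real.log n := Real.log_le_log (by norm_num) (by exact_mod_cast hn)
  linarith [Real.log_two_gt_d9]

/-- Because `X / T ≤ 1`, only the deterministic denominator `F` has to be bounded below. -/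
lemma utility_error_bound {X T x F d e N : ℝ} (hX0 : 0 ≤ X) (hXT : X ≤ T) (hT : 0 < T)
    (hN : 0 < N) (hF : N ≤ F) (h1 : |X - x| ≤ d) (h2 : |T - F| ≤ e) :
    |X / T - x / F| ≤ (d + e) / N := by
  have hF0 : 0 < F := hN.trans_le hF
  have : X / T - x / F = ((X - x) + X / T * (F - T)) / F := by field_simp; ring
  rw [this, abs_div, abs_of_pos hF0]
  have hd : 0 ≤ d := (abs_nonneg _).trans h1
  have he : 0 ≤ e := (abs_nonneg _).trans h2
  have h3 : |X - x + X / T * (F - T)| ≤ d + e := by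
    refine (abs_add_le _ _).trans (add_le_add h1 ?_)
    rw [abs_mul, abs_of_nonneg (by positivity : 0 ≤ X / T), abs_sub_comm]
    calc X / T * |T - F| ≤ 1 * e := mul_le_mul ((div_le_one hT).2 hXT) h2 (abs_nonneg _) zero_le_one
      _ = e := one_mul e
  gcongr

lemma uniform_le_prob (G₁ : Finset (Fin n)) (hβ : 0 < β) (hβ1 : β ≤ 1) :
    (unifLaw n).real {u | ∀ i ∈ G₁, u i ≤ β} = β ^ G₁.card := by
  classical
  have : {u : Fin n → ℝ | ∀ i ∈ G₁, u i ≤ β} =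
      Set.univ.pi fun i => if i ∈ G₁ then Set.Iic β else Set.univ := by
    ext u
    simp only [Set.mem_ofPred_eq, Set.mem_pi, Set.mem_univ, true_implies]
    refine forall_congr' fun i => ?_
    by_cases h : i ∈ G₁ <;> simp [h]
  have hI : uniform01 (Set.Iic β) = ENNReal.ofReal β := by
    rw [uniform01, Measure.restrict_apply measurableSet_Iic]
    have : Set.Iic β ∩ Set.Icc 0 1 = Set.Icc 0 β := by
      ext t
      simp only [Set.mem_inter_iff, Set.mem_Iic, Set.mem_Icc]
      constructor
      · exact fun h => ⟨h.2.1, h.1⟩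
      · exact fun h => ⟨h.2, h.1, h.2.trans hβ1⟩
    rw [this]; simp
  rw [this, Measure.real, unifLaw, Measure.pi_pi]
  have h2 : ∀ i, uniform01 (if i ∈ G₁ then Set.Iic β else Set.univ) =
      if i ∈ G₁ then ENNReal.ofReal β else 1 := by
    intro i; split_ifs
    · exact hI
    · simp
  simp only [h2]
  rw [Finset.prod_ite_mem, Finset.univ_inter, Finset.prod_const, ENNReal.toReal_pow,
    ENNReal.toReal_ofReal hβ.le]

/-- The data of the model together with the limiting rates. -/
lemma rates_of_groups (hG₁ : 0 < G₁.card) (hG₂ : 0 < G₁ᶜ.card) {K : ℕ} (hK0 : 0 < K) (hK : K ≤ n)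
    (hβ : 0 < β) (hβ1 : β ≤ 1) :
    ∃ r₁ r₂ : ℝ, alphaOne G₁.card G₁ᶜ.card K β = G₁.card * r₁ ∧
      alphaTwo G₁.card G₁ᶜ.card K β = G₁ᶜ.card * r₂ ∧ 0 ≤ r₂ ∧ r₂ ≤ r₁ ∧ r₁ ≤ 1 ∧
      fairValue G₁.card G₁ᶜ.card K β = r₂ / r₁ ∧
      (∀ u : ℝ, u ≤ 1 → (1 - r₁ < β * u ↔ 1 - r₂ < u)) ∧
      (K : ℝ) = G₁.card * r₁ + G₁ᶜ.card * r₂ ∧ (K : ℝ) ≤ n * r₁ := by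
  have hcard : (G₁.card : ℝ) + G₁ᶜ.card = n := by
    exact_mod_cast (Finset.card_add_card_compl G₁).trans (by simp)
  obtain ⟨r₁, r₂, h1, h2, h3, h4, h5, h6, h7⟩ := exists_rates (n₁ := G₁.card) (n₂ := G₁ᶜ.card)
    (K := K) (by exact_mod_cast hG₁) (by exact_mod_cast hG₂) (by exact_mod_cast hK0)
    (by rw [hcard]; exact_mod_cast hK) hβ hβ1
  have hKeq : (K : ℝ) = G₁.card * r₁ + G₁ᶜ.card * r₂ := by
    rw [← h1, ← h2, alphaTwo]; ring
  refine ⟨r₁, r₂, h1, h2, h3, h4, h5, h6, h7, hKeq, ?_⟩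
  rw [hKeq, ← hcard, add_mul]
  gcongr

end Main

/-! ### The three quantitative bounds. -/

section Bounds

variable {n p : ℕ} (L : Measure (PrefList p)) [IsProbabilityMeasure L]
  {k : Fin p → ℕ} {G₁ : Finset (Fin n)} {β η₁ η₂ : ℝ}

lemma sqrt_div_self_eq (n : ℕ) : Real.sqrt n / n = 1 / Real.sqrt n := by
  rw [Real.sqrt_div_self, one_div]

/-- The deviation of the capped and uncapped ratios of selection rates from their limit. -/
lemma ratio_error_bound {r₁ r₂ : ℝ} (hn : 0 < n) (hη₁ : 0 < η₁) (hη₂ : 0 < η₂)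
    (hG₁ : η₁ * n ≤ G₁.card) (hG₂ : η₁ * n ≤ G₁ᶜ.card) (h0 : 0 ≤ r₂) (h21 : r₂ ≤ r₁)
    (h1 : r₁ ≤ 1) {K : ℕ} (hKη : η₂ * n ≤ K) (hKr : (K : ℝ) ≤ n * r₁)
    (hK : (K : ℝ) = G₁.card * r₁ + G₁ᶜ.card * r₂)
    (hthr : ∀ u : ℝ, u ≤ 1 → (1 - r₁ < β * u ↔ 1 - r₂ < u)) {u : Fin n → ℝ}
    (hu : ∀ i, u i ∈ Set.Icc (0 : ℝ) 1) {S : Finset (Fin n)} (hS : IsTop K (estimated G₁ β u) S) :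
    |groupRatio G₁ S - r₂ / r₁| ≤ 4 / (η₁ * η₂ * n) * countDev G₁ r₁ r₂ u ∧
    |cappedRatio (G₁.card / G₁ᶜ.card) S G₁ᶜ - r₂ / r₁| ≤
      4 / (η₁ * η₂ * n) * countDev G₁ r₁ r₂ u := by
  have hn' : (0 : ℝ) < n := by exact_mod_cast hn
  have hN : 0 < η₁ * n := by positivity
  -- From `η₂ n ≤ K ≤ n r₁`; this keeps the denominator of `v = r₂ / r₁` away from zero.
  have hr : η₂ ≤ r₁ := le_of_mul_le_mul_right (by linarith) hn'
  have hr0 : 0 < r₁ := hη₂.trans_le hr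
  obtain ⟨e1, e2, -⟩ := hS.abs_card_sub_le hr0.le h1 h0 (h21.trans h1) hK hthr hu
  have f1 := abs_frac_sub_le hN hG₁ e1
  have f2 := abs_frac_sub_le hN hG₂ e2
  have hfin : 2 * (2 * countDev G₁ r₁ r₂ u / (η₁ * n)) / r₁ ≤
      4 / (η₁ * η₂ * n) * countDev G₁ r₁ r₂ u := by
    have hd := countDev_nonneg G₁ r₁ r₂ u
    calc 2 * (2 * countDev G₁ r₁ r₂ u / (η₁ * n)) / r₁
        ≤ 2 * (2 * countDev G₁ r₁ r₂ u / (η₁ * n)) / η₂ := by gcongr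
      _ = 4 / (η₁ * η₂ * n) * countDev G₁ r₁ r₂ u := by field_simp; ring
  have hmin := abs_min_sub_le f1 f2 h21
  have hmin0 : 0 ≤ min (frac S G₁) (frac S G₁ᶜ) := le_min (frac_nonneg _ _) (frac_nonneg _ _)
  refine ⟨(abs_div_sub_le hmin0 min_le_max hr0 h21 h0 hmin (abs_max_sub_le f1 f2 h21)).trans hfin,
    ?_⟩
  rw [cappedRatio_eq G₁ S (by exact_mod_cast hN.trans_le hG₁) (by exact_mod_cast hN.trans_le hG₂)]
  exact (abs_div_sub_le hmin0 (min_le_left _ _) hr0 h21 h0 hmin f1).trans hfin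

lemma integral_const_mul_countDev_le (hn : 0 < n) (hη₁ : 0 < η₁) (hη₂ : 0 < η₂) (r₁ r₂ : ℝ) :
    ∫ u, 4 / (η₁ * η₂ * n) * countDev G₁ r₁ r₂ u ∂(unifLaw n) ≤ 8 / (η₁ * η₂ * Real.sqrt n) := by
  have hn' : (0 : ℝ) < n := by exact_mod_cast hn
  rw [integral_const_mul]
  calc 4 / (η₁ * η₂ * n) * ∫ u, countDev G₁ r₁ r₂ u ∂(unifLaw n)
      ≤ 4 / (η₁ * η₂ * n) * (2 * Real.sqrt n) := by
        gcongr
        exact (integrable_countDev G₁ r₁ r₂).2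
    _ = 8 / (η₁ * η₂) * (Real.sqrt n / n) := by field_simp; ring
    _ = 8 / (η₁ * η₂ * Real.sqrt n) := by rw [sqrt_div_self_eq]; field_simp

lemma abs_repFairness_sub_le {A : Algorithm n p} (hA : MaximizesEstimatedUtility k A) (hn : 0 < n)
    (hK : ∑ l, k l ≤ n) (hβ : 0 < β) (hβ1 : β ≤ 1) (hη₁ : 0 < η₁) (hη₂ : 0 < η₂)
    (hG₁ : η₁ * n ≤ G₁.card) (hG₂ : η₁ * n ≤ G₁ᶜ.card) (hKη : η₂ * n ≤ (∑ l, k l : ℕ)) :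
    |repFairness uniform01 L A G₁ β - fairValue G₁.card G₁ᶜ.card (∑ l, k l : ℕ) β| ≤
      8 / (η₁ * η₂ * Real.sqrt n) := by
  have hn' : (0 : ℝ) < n := by exact_mod_cast hn
  have hN : 0 < η₁ * n := by positivity
  have hK0 : 0 < ∑ l, k l := by
    have : (0 : ℝ) < (∑ l, k l : ℕ) := lt_of_lt_of_le (by positivity) hKη
    exact_mod_cast this
  obtain ⟨r₁, r₂, -, -, h3, h4, h5, h6, h7, h8, h9⟩ := rates_of_groups (G₁ := G₁)
    (by exact_mod_cast hN.trans_le hG₁) (by exact_mod_cast hN.trans_le hG₂) hK0 hK hβ hβ1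
  rw [h6]
  refine (abs_integral_law_sub_le L (integrable_repRatio L hA hK hβ)
    ((integrable_countDev G₁ r₁ r₂).1.const_mul (4 / (η₁ * η₂ * n))) ?_).trans
    (integral_const_mul_countDev_le hn hη₁ hη₂ r₁ r₂)
  filter_upwards [ae_law_of_ae L ae_pos, ae_law_of_ae L ae_mem_Icc] with w h1 h2
  exact (ratio_error_bound hn hη₁ hη₂ hG₁ hG₂ h3 h4 h5 hKη h9 h8 h7 h2
    (isTop_selected hA hK hβ h1 w.2)).1

lemma abs_utilityRatio_sub_le {A : Algorithm n p} (hA : MaximizesEstimatedUtility k A) (hn : 0 < n)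
    (hK : ∑ l, k l ≤ n) (hβ : 0 < β) (hβ1 : β ≤ 1) (hη₂ : 0 < η₂)
    (hG₁ : 0 < G₁.card) (hG₂ : 0 < G₁ᶜ.card) (hKη : η₂ * n ≤ (∑ l, k l : ℕ)) :
    |utilityRatio uniform01 L k A G₁ β -
      (topMean (alphaOne G₁.card G₁ᶜ.card (∑ l, k l : ℕ) β) G₁.card +
        topMean (alphaTwo G₁.card G₁ᶜ.card (∑ l, k l : ℕ) β) G₁ᶜ.card) /
          topMean (∑ l, k l : ℕ) n| ≤ 18 / (η₂ * Real.sqrt n) := by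
  have hn' : (0 : ℝ) < n := by exact_mod_cast hn
  set K := ∑ l, k l with hKdef
  have hKR : (0 : ℝ) < K := lt_of_lt_of_le (by positivity) hKη
  have hK0 : 0 < K := by exact_mod_cast hKR
  have hKn : (K : ℝ) ≤ n := by exact_mod_cast hK
  have hcard : (G₁.card : ℝ) + G₁ᶜ.card = n := by
    exact_mod_cast (Finset.card_add_card_compl G₁).trans (by simp)
  obtain ⟨r₁, r₂, h1, h2, h3, h4, h5, -, h7, h8, -⟩ := rates_of_groups hG₁ hG₂ hK0 hK hβ hβ1
  -- The denominator is the same problem with `β = 1`, where both groups have the rate `K / n`.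
  set r : ℝ := K / n with hr
  have hr0 : 0 ≤ r := by positivity
  have hr1 : r ≤ 1 := (div_le_one hn').2 hKn
  have hnr : n * r = K := by rw [hr]; field_simp
  have hKr : (K : ℝ) = G₁.card * r + G₁ᶜ.card * r := by rw [← add_mul, hcard, hnr]
  rw [h1, h2]
  have hi1 := integrable_countDev G₁ r₁ r₂
  have hi2 := integrable_sumDev_utilWeight G₁ h5 (h4.trans h5)
  have hi3 := integrable_countDev G₁ r r
  have hi4 := integrable_sumDev_utilWeight G₁ hr1 hr1
  have hj1 : Integrable (fun u => countDev G₁ r₁ r₂ u + sumDev (utilWeight G₁ r₁ r₂) u + 2)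
      (unifLaw n) := (hi1.1.add hi2.1).add (integrable_const _)
  have hj2 : Integrable (fun u => countDev G₁ r r u + sumDev (utilWeight G₁ r r) u + 1)
      (unifLaw n) := (hi3.1.add hi4.1).add (integrable_const _)
  have hN : 0 < η₂ * n / 2 := by positivity
  refine (abs_integral_law_sub_le L (integrable_utilRatio L hA hK hβ)
    (d := fun u => ((countDev G₁ r₁ r₂ u + sumDev (utilWeight G₁ r₁ r₂) u + 2) +
      (countDev G₁ r r u + sumDev (utilWeight G₁ r r) u + 1)) / (η₂ * n / 2))
    ((hj1.add hj2).div_const _) ?_).trans ?_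
  · filter_upwards [ae_law_of_ae L ae_pos, ae_law_of_ae L ae_mem_Icc] with w hw hw2
    have hsel := isTop_selected (G₁ := G₁) hA hK hβ hw w.2
    have htop := isTop_topSet hK w.1
    have hX := hsel.abs_card_sub_le (h3.trans h4) h5 h3 (h4.trans h5) h8 h7 hw2
    have hT := IsTop.abs_card_sub_le (G := G₁) (β := 1) hr0 hr1 hr0 hr1 hKr
      (fun u _ => by rw [one_mul]) hw2 (by rw [estimated_one]; exact htop)
    have hm1 := abs_topMean_sub_le (n := (G₁.card : ℝ)) (Nat.cast_nonneg _) (h3.trans h4) h5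
    have hm2 := abs_topMean_sub_le (n := (G₁ᶜ.card : ℝ)) (Nat.cast_nonneg _) h3 (h4.trans h5)
    have hm3 := abs_topMean_sub_le hn'.le hr0 hr1
    rw [hnr] at hm3
    refine utility_error_bound (Finset.sum_nonneg fun i _ => (hw i).le) ?_ ?_ hN
      (le_trans (by linarith) (half_le_topMean hKR.le hKn)) ?_ ?_
    · rw [topSum_eq_sum]
      exact htop.sum_le (fun i => (hw i).le) hsel.1.le
    · rw [topSum_eq_sum]
      exact Finset.sum_pos (fun i _ => hw i) (Finset.card_pos.1 (by rw [htop.1]; exact hK0))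
    · have := hX.2.2
      rw [utility]
      rw [abs_le] at *
      constructor <;> linarith
    · have := hT.2.2
      rw [topSum_eq_sum]
      have e : (G₁.card : ℝ) * (1 - (1 - r) ^ 2) / 2 + G₁ᶜ.card * (1 - (1 - r) ^ 2) / 2 =
          n * (1 - (1 - r) ^ 2) / 2 := by rw [← hcard]; ring
      rw [e] at this
      rw [abs_le] at *
      constructor <;> linarith
  · rw [integral_div, integral_add hj1 hj2,
      integral_add (f := fun u => countDev G₁ r₁ r₂ u + sumDev (utilWeight G₁ r₁ r₂) u)
        (hi1.1.add hi2.1) (integrable_const _),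
      integral_add (f := fun u => countDev G₁ r r u + sumDev (utilWeight G₁ r r) u)
        (hi3.1.add hi4.1) (integrable_const _), integral_add hi1.1 hi2.1, integral_add hi3.1 hi4.1]
    simp only [integral_const, probReal_univ, one_smul]
    have hs1 : 1 ≤ Real.sqrt n := Real.one_le_sqrt.2 (by exact_mod_cast hn)
    -- The deviations contribute `(2 + 1) + (2 + 1)` times `√n`, and the three replacements of
    -- `topMean` contribute `3 ≤ 3√n`.
    calc _ ≤ 9 * Real.sqrt n / (η₂ * n / 2) := by
          gcongr
          linarith [hi1.2, hi2.2, hi3.2, hi4.2]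
      _ = 18 / η₂ * (Real.sqrt n / n) := by field_simp; ring
      _ = 18 / (η₂ * Real.sqrt n) := by rw [sqrt_div_self_eq]; field_simp

lemma prefFairness_le (hk : ∀ l, 0 < k l) (hn : 0 < n) (hK : ∑ l, k l ≤ n) (hβ : 0 < β)
    (hβ1 : β ≤ 1) (hη₁ : 0 < η₁) (hη₂ : 0 < η₂) (hG₁ : η₁ * n ≤ G₁.card)
    (hG₂ : η₁ * n ≤ G₁ᶜ.card) (hKη : η₂ * n ≤ (∑ l, k l : ℕ)) :
    prefFairness uniform01 L (stableAlg k) G₁ β ≤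
      fairValue G₁.card G₁ᶜ.card (∑ l, k l : ℕ) β + 10 / (η₁ * η₂ * Real.sqrt n) := by
  classical
  have hn' : (0 : ℝ) < n := by exact_mod_cast hn
  have hN : 0 < η₁ * n := by positivity
  have hg₁ : 0 < G₁.card := by exact_mod_cast hN.trans_le hG₁
  have hg₂ : 0 < G₁ᶜ.card := by exact_mod_cast hN.trans_le hG₂
  have hK0 : 0 < ∑ l, k l := by
    have : (0 : ℝ) < (∑ l, k l : ℕ) := lt_of_lt_of_le (by positivity) hKη
    exact_mod_cast this
  have hcard : (G₁.card : ℝ) + G₁ᶜ.card = n := by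
    exact_mod_cast (Finset.card_add_card_compl G₁).trans (by simp)
  obtain ⟨r₁, r₂, -, -, h3, h4, h5, h6, h7, h8, h9⟩ := rates_of_groups hg₁ hg₂ hK0 hK hβ hβ1
  set c : ℝ := (G₁.card : ℝ) / G₁ᶜ.card with hc
  obtain ⟨hgapi, hgap⟩ := integral_cappedGap_nonneg L hk hK hK0 (c := c) (by positivity) hβ hβ1 G₁
  set v := fairValue G₁.card G₁ᶜ.card (∑ l, k l : ℕ) β with hv
  set B : Set (Fin n → ℝ) := {u | ∀ i ∈ G₁, u i ≤ β} with hB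
  have hBm : MeasurableSet B := by
    have : B = ⋂ i ∈ G₁, {u | u i ≤ β} := by ext; simp [hB]
    rw [this]
    exact G₁.measurableSet_biInter fun i _ =>
      measurableSet_le (measurable_pi_apply i) measurable_const
  have hd := (integrable_countDev G₁ r₁ r₂).1.const_mul (4 / (η₁ * η₂ * n))
  have hBi : Integrable (B.indicator fun _ => 1 - v) (unifLaw n) :=
    (integrable_const _).indicator hBm
  -- If some estimated utility exceeds `β`, the capped ratio of first choosers is that of the top
  -- set minus the gap. Otherwise `u ∈ B`, the gap is zero, and `v + (1 - v) = 1` is a trivial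
  -- bound.
  have hpt : ∀ᵐ u ∂(unifLaw n),
      ∫ s, prefRatio (stableAlg k) G₁ β (u, s) ∂(Measure.pi fun _ : Fin n => L) ≤
        (v + B.indicator (fun _ => 1 - v) u + 4 / (η₁ * η₂ * n) * countDev G₁ r₁ r₂ u) -
          cappedGap L k c β (estimated G₁ β u) G₁ᶜ := by
    filter_upwards [ae_mem_Icc] with u hu
    have hdev : 0 ≤ 4 / (η₁ * η₂ * n) * countDev G₁ r₁ r₂ u :=
      mul_nonneg (by positivity) (countDev_nonneg _ _ _ _)
    by_cases hE : ∃ i, β < estimated G₁ β u i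
    · have huB : u ∉ B := by
        obtain ⟨i, hi⟩ := hE
        intro h
        by_cases hiG : i ∈ G₁
        · rw [estimated, if_pos hiG] at hi
          exact (h i hiG).not_gt hi
        · rw [estimated, if_neg hiG] at hi
          nlinarith [(hu i).2]
      rw [Set.indicator_of_notMem huB, cappedGap, Set.indicator_of_mem (by exact hE)]
      have hS := (ratio_error_bound hn hη₁ hη₂ hG₁ hG₂ h3 h4 h5 hKη h9 h8 h7 hu
        (isTop_topSet hK (estimated G₁ β u))).2
      rw [← h6] at hS
      have hle : ∫ s, prefRatio (stableAlg k) G₁ β (u, s) ∂(Measure.pi fun _ : Fin n => L) ≤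
          ∫ s, cappedRatio c (firstChoosers k s (byDecreasing (estimated G₁ β u)) fun _ => none) G₁ᶜ
            ∂(Measure.pi fun _ : Fin n => L) := by
        refine integral_mono Integrable.of_finite Integrable.of_finite fun s => ?_
        simp only [prefRatio, gotFirst_stableAlg]
        exact groupRatio_le_cappedRatio _ _ hg₁ hg₂
      linarith [(abs_le.1 hS).2]
    · have huB : u ∈ B := by
        intro i hi
        push Not at hE
        have := hE i
        rwa [estimated, if_pos hi] at this
      rw [Set.indicator_of_mem huB, cappedGap, Set.indicator_of_notMem (by exact hE)]
      have hle : ∫ s, prefRatio (stableAlg k) G₁ β (u, s) ∂(Measure.pi fun _ : Fin n => L) ≤ 1 :=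
        (integral_mono Integrable.of_finite (integrable_const (1 : ℝ))
          fun s => groupRatio_le_one _ _).trans_eq (by simp)
      linarith
  have hint : Integrable (prefRatio (stableAlg k) G₁ β) (law n uniform01 L) :=
    integrable_prefRatio L
  have hsub := one_sub_fairValue_mul_pow_le (n₁ := G₁.card) (n₂ := G₁ᶜ.card)
    (K := (∑ l, k l : ℕ)) hg₁ (by exact_mod_cast hg₂) (by rw [hcard]; exact_mod_cast hK) hβ hβ1
    hη₁ hη₂ (by rw [hcard]; exact hG₁) (by rw [hcard]; exact hKη)
  rw [hcard, ← hv] at hsub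
  have hs1 : 1 ≤ Real.sqrt n := Real.one_le_sqrt.2 (by exact_mod_cast hn)
  have hsn : Real.sqrt n ≤ n := by nlinarith [Real.mul_self_sqrt hn'.le]
  calc prefFairness uniform01 L (stableAlg k) G₁ β
      = ∫ u, ∫ s, prefRatio (stableAlg k) G₁ β (u, s) ∂(Measure.pi fun _ : Fin n => L)
          ∂(unifLaw n) := integral_prod _ hint
    _ ≤ ∫ u, ((v + B.indicator (fun _ => 1 - v) u +
          4 / (η₁ * η₂ * n) * countDev G₁ r₁ r₂ u) -
            cappedGap L k c β (estimated G₁ β u) G₁ᶜ) ∂(unifLaw n) :=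
        integral_mono_ae hint.integral_prod_left
          ((((integrable_const v).add hBi).add hd).sub hgapi) hpt
    _ = v + (1 - v) * β ^ G₁.card +
          ∫ u, 4 / (η₁ * η₂ * n) * countDev G₁ r₁ r₂ u ∂(unifLaw n) -
            ∫ u, cappedGap L k c β (estimated G₁ β u) G₁ᶜ ∂(unifLaw n) := by
        rw [integral_sub (f := fun u => v + B.indicator (fun _ => 1 - v) u +
            4 / (η₁ * η₂ * n) * countDev G₁ r₁ r₂ u) (((integrable_const v).add hBi).add hd) hgapi,
          integral_add (f := fun u => v + B.indicator (fun _ => 1 - v) u)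
            ((integrable_const v).add hBi) hd, integral_add (integrable_const v) hBi,
          integral_indicator hBm, setIntegral_const, uniform_le_prob G₁ hβ hβ1]
        simp [mul_comm]
    _ ≤ v + 2 / (η₁ * η₂ * n) + 8 / (η₁ * η₂ * Real.sqrt n) - 0 := by
        gcongr
        exact integral_const_mul_countDev_le hn hη₁ hη₂ r₁ r₂
    _ ≤ v + 2 / (η₁ * η₂ * Real.sqrt n) + 8 / (η₁ * η₂ * Real.sqrt n) := by
        rw [sub_zero]
        gcongr
    _ = v + 10 / (η₁ * η₂ * Real.sqrt n) := by ring

end Bounds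

end CentralSelection

open CentralSelection
theorem mainTheorem3 :
    ∃ C : ℝ, 0 < C ∧
      ∀ (n p : ℕ) (G₁ : Finset (Fin n)) (k : Fin p → ℕ) (β η₁ η₂ : ℝ)
        (L : MeasureTheory.Measure (PrefList p)) (_ : MeasureTheory.IsProbabilityMeasure L)
        (n₁ n₂ K : ℕ),
        0 < n → n₁ = G₁.card → n₂ = G₁ᶜ.card → K = ∑ l, k l →
        0 < β → β ≤ 1 → 0 < η₁ → 0 < η₂ →
        η₁ * n ≤ n₁ → η₁ * n ≤ n₂ → η₂ * n ≤ K → K ≤ n →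
        (∀ A : Algorithm n p, MaximizesEstimatedUtility k A →
          (MeasureTheory.Integrable (repRatio A G₁ β) (law n uniform01 L) ∧
            |repFairness uniform01 L A G₁ β - fairValue n₁ n₂ K β| ≤
              C * (Real.sqrt (Real.log n) / (η₁ * η₂ * Real.sqrt n))) ∧
          (MeasureTheory.Integrable (utilRatio k A G₁ β) (law n uniform01 L) ∧
            |utilityRatio uniform01 L k A G₁ β -
                (topMean (alphaOne n₁ n₂ K β) n₁ + topMean (alphaTwo n₁ n₂ K β) n₂) /
                  topMean K n| ≤
              C * (Real.sqrt (Real.log n) / (η₂ * Real.sqrt n)))) ∧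
        ((∀ l, 0 < k l) →
          MeasureTheory.Integrable (prefRatio (stableAlg k) G₁ β) (law n uniform01 L) ∧
            prefFairness uniform01 L (stableAlg k) G₁ β ≤
              fairValue n₁ n₂ K β +
                C * (p * Real.sqrt (Real.log n) / (η₁ * η₂ * Real.sqrt n))) := by
  -- The constants found are `8`, `18` and `10`; since `√log n ≥ 1/2`, twice the largest suffices.
  refine ⟨36, by norm_num, ?_⟩
  intro n p G₁ k β η₁ η₂ L _ n₁ n₂ K hn hn₁ hn₂ hKdef hβ hβ1 hη₁ hη₂ hG₁ hG₂ hKη hK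
  subst hn₁ hn₂ hKdef
  have hn' : (0 : ℝ) < n := by exact_mod_cast hn
  have hN : 0 < η₁ * n := by positivity
  have hg₁ : 0 < G₁.card := by exact_mod_cast hN.trans_le hG₁
  have hg₂ : 0 < G₁ᶜ.card := by exact_mod_cast hN.trans_le hG₂
  have hn2 : 2 ≤ n := by
    have := (Finset.card_add_card_compl G₁).trans (Fintype.card_fin n)
    omega
  have hlog := sqrt_log_ge hn2
  have hs : 0 < Real.sqrt n := Real.sqrt_pos.2 hn'
  have hcmp : ∀ a D ℓ : ℝ, a ≤ 18 → 0 < D → 1 / 2 ≤ ℓ → a / D ≤ 36 * (ℓ / D) := by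
    intro a D ℓ ha hD hℓ
    rw [← mul_div_assoc]
    gcongr
    linarith
  refine ⟨fun A hA => ⟨⟨integrable_repRatio L hA hK hβ, ?_⟩, integrable_utilRatio L hA hK hβ, ?_⟩,
    fun hk => ⟨integrable_prefRatio L, ?_⟩⟩
  · exact (abs_repFairness_sub_le L hA hn hK hβ hβ1 hη₁ hη₂ hG₁ hG₂ hKη).trans
      (hcmp _ _ _ (by norm_num) (by positivity) hlog)
  · exact (abs_utilityRatio_sub_le L hA hn hK hβ hβ1 hη₂ hg₁ hg₂ hKη).trans
      (hcmp _ _ _ le_rfl (by positivity) hlog)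
  · refine (prefFairness_le L hk hn hK hβ hβ1 hη₁ hη₂ hG₁ hG₂ hKη).trans ?_
    have hp : (1 : ℝ) ≤ p := by
      have : 0 < p := by
        rcases p.eq_zero_or_pos with h | h
        · subst h
          have : (0 : ℝ) < η₂ * n := by positivity
          simp at hKη
          linarith
        · exact h
      exact_mod_cast this
    gcongr
    exact hcmp _ _ _ (by norm_num) (by positivity) (by nlinarith)
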